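/- A Jordan–Lipschitz domain is a bounded, simply connected domain $\Omega\subset\mathbb{R}^2=\mathbb{C}$ whose boundary is a Jordan curve and is locally, after a rotation, the graph of a Lipschitz function with $\Omega$ on one side. Write $L(\Omega)$ for the length of $\partial\Omega$. For $\beta\in\mathbb{R}$ let $\lambda_1(\Omega;\beta)$ be the first eigenvalue of the Robin Laplacian, $-\Delta u=\lambda u$ in $\Omega$, $\partial u/\partial\nu+\beta u=0$ on $\partial\Omega$, that is, \[ \lambda_1(\Omega;\beta)=\inf_{0\neq u\in H^1(\Omega)}\frac{\int_\Omega|\nabla u|^2\,dx+\beta\int_{\partial\Omega}u^2\,ds}{\int_\Omega u^2\,dx}, \] where the boundary values of $u$ are taken in the sense of traces. Let $\mathbb{D}$ be the open unit disk. Theorem E. Let $\alpha>0$. Suppose $F:\mathbb{D}\to\Omega$ is a conformal map (a holomorphic bijection) of $\mathbb{D}$ onto a Jordan–Lipschitz domain $\Omega$. Then \[ \lambda_1\big(\Omega;\alpha/L(\Omega)\big)\,|F'(0)|^2 \] is maximal (among all conformal maps of $\mathbb{D}$ onto Jordan–Lipschitz domains, with $\alpha$ fixed) if and only if $F$ is linear,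 i.e. $F(z)=az+b$ on $\mathbb{D}$ for some $a,b\in\mathbb{C}$, and $\Omega$ is an open disk. Moreover \[ \lambda_1\big(\Omega;\alpha/L(\Omega)\big)\,|F'(0)|^2\le\lambda_1\big(\mathbb{D};\alpha/L(\mathbb{D})\big), \] with equality if and only if $F$ is linear and $\Omega$ is a disk. -/

import Mathlib

open MeasureTheory Filter Topology
open scoped ContDiff

noncomputable section

namespace Robin

/-- The open set `Ω ⊆ ℂ = ℝ²` has Lipschitz boundary: near every boundary point, after a rotation
(multiplication by `c` with `|c| = 1`), `Ω` is the region above the graph of a Lipschitz function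
`b`. -/
def HasLipschitzBoundary (Ω : Set ℂ) : Prop :=
  ∀ p ∈ frontier Ω, ∃ (c : ℂ) (b : ℝ → ℝ) (K : NNReal) (r : ℝ),
    ‖c‖ = 1 ∧ LipschitzWith K b ∧ 0 < r ∧
      ∀ z ∈ Metric.ball p r, z ∈ Ω ↔ b (c * z).re < (c * z).im

/-- A Jordan curve: the image of the unit circle under a continuous injective map. -/
def IsJordanCurve (J : Set ℂ) : Prop :=
  ∃ γ : Circle → ℂ, Continuous γ ∧ Function.Injective γ ∧ Set.range γ = J

/-- A Jordan–Lipschitz domain: a bounded simply connected planar domain whose boundary is a Jordan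
curve, and which has Lipschitz boundary. -/
structure IsJordanLipschitzDomain (Ω : Set ℂ) : Prop where
  isOpen : IsOpen Ω
  isBounded : Bornology.IsBounded Ω
  simplyConnected : SimplyConnectedSpace Ω
  jordan : IsJordanCurve (frontier Ω)
  lipschitz : HasLipschitzBoundary Ω

/-- `F` is a conformal map of the open unit disk onto `Ω`: holomorphic, injective, and onto. -/
structure IsConformalOnto (F : ℂ → ℂ) (Ω : Set ℂ) : Prop where
  holomorphic : DifferentiableOn ℂ F (Metric.ball 0 1)
  injOn : Set.InjOn F (Metric.ball 0 1)
  image_eq : F '' Metric.ball 0 1 = Ω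

/-- Arclength measure on the boundary of `Ω` (one-dimensional Hausdorff measure). -/
def arclength (Ω : Set ℂ) : Measure ℂ := (μH[1] : Measure ℂ).restrict (frontier Ω)

/-- The perimeter `L(Ω)`, the length of the boundary. -/
def perimeter (Ω : Set ℂ) : ℝ := (μH[1] (frontier Ω)).toReal

/-- `G` is the weak gradient of `u` on the open set `Ω` (a vector `v ∈ ℝ²` is a complex number):
`∫_Ω u ∂_v φ = - ∫_Ω (G · v) φ` for all test functions `φ ∈ C_c^∞(Ω)` and directions `v`. -/
def IsWeakGradient (Ω : Set ℂ) (u : ℂ → ℝ) (G : ℂ → ℂ) : Prop :=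
  ∀ φ : ℂ → ℝ, ContDiff ℝ ∞ φ → HasCompactSupport φ → tsupport φ ⊆ Ω → ∀ v : ℂ,
    ∫ x in Ω, u x * fderiv ℝ φ x v = - ∫ x in Ω, inner ℝ (G x) v * φ x

/-- `u ∈ H¹(Ω)`, with weak gradient `G`. -/
structure MemH1 (Ω : Set ℂ) (u : ℂ → ℝ) (G : ℂ → ℂ) : Prop where
  memLp : MemLp u 2 (volume.restrict Ω)
  memLp_grad : MemLp G 2 (volume.restrict Ω)
  isWeakGradient : IsWeakGradient Ω u G

/-- `g ∈ L²(∂Ω)` is the boundary trace of `u ∈ H¹(Ω)` (with weak gradient `G`): there are smooth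
functions on the plane which converge to `u` in `H¹(Ω)` and whose boundary values converge to `g`
in `L²(∂Ω)`. On a bounded Lipschitz domain this describes the usual trace operator, the continuous
extension of the restriction map from `C^∞(closure Ω)` to `H¹(Ω)`. -/
def IsTrace (Ω : Set ℂ) (u : ℂ → ℝ) (G : ℂ → ℂ) (g : ℂ → ℝ) : Prop :=
  MemLp g 2 (arclength Ω) ∧
  ∃ φ : ℕ → ℂ → ℝ, (∀ n, ContDiff ℝ ∞ (φ n)) ∧
    Tendsto (fun n => eLpNorm (fun x => φ n x - u x) 2 (volume.restrict Ω)) atTop (𝓝 0) ∧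
    Tendsto (fun n => eLpNorm (fun x => gradient (φ n) x - G x) 2 (volume.restrict Ω))
      atTop (𝓝 0) ∧
    Tendsto (fun n => eLpNorm (fun x => φ n x - g x) 2 (arclength Ω)) atTop (𝓝 0)

/-- The Rayleigh quotient of the Robin Laplacian with parameter `β`, for a function `u` with weak
gradient `G` and boundary trace `g`. -/
def rayleigh (Ω : Set ℂ) (β : ℝ) (u : ℂ → ℝ) (G : ℂ → ℂ) (g : ℂ → ℝ) : ℝ :=
  ((∫ x in Ω, ‖G x‖ ^ 2) + β * ∫ x, g x ^ 2 ∂(arclength Ω)) / ∫ x in Ω, u x ^ 2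

/-- The first eigenvalue `λ₁(Ω; β)` of the Robin Laplacian (`-Δu = λu` in `Ω`, `∂u/∂ν + βu = 0` on
`∂Ω`): the infimum of the Rayleigh quotient over all nonzero `u ∈ H¹(Ω)`. -/
def firstEigenvalue (Ω : Set ℂ) (β : ℝ) : ℝ :=
  sInf {q : ℝ | ∃ (u : ℂ → ℝ) (G : ℂ → ℂ) (g : ℂ → ℝ), MemH1 Ω u G ∧ IsTrace Ω u G g ∧
    0 < (∫ x in Ω, u x ^ 2) ∧ q = rayleigh Ω β u G g}

/-- The scale invariant quantity `λ₁(Ω; α / L(Ω)) |F'(0)|²`. -/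
def scaledEigenvalue (α : ℝ) (F : ℂ → ℂ) (Ω : Set ℂ) : ℝ :=
  firstEigenvalue Ω (α / perimeter Ω) * ‖deriv F 0‖ ^ 2

/-- `F` is linear on the unit disk, that is, `F(z) = az + b` there. -/
def IsLinearOnDisk (F : ℂ → ℂ) : Prop :=
  ∃ a b : ℂ, ∀ z ∈ Metric.ball (0 : ℂ) 1, F z = a * z + b

/-- `Ω` is an open disk (of positive radius). -/
def IsDisk (Ω : Set ℂ) : Prop :=
  ∃ (c : ℂ) (r : ℝ), 0 < r ∧ Ω = Metric.ball c r

end Robin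

end

/-! The ground state of the unit disk is radial: `bessel 0 (T * ‖z‖ ^ 2)`, that is J₀(2√T|z|), with
eigenvalue 4T, where T solves the Robin condition with parameter α/(2π) (`exists_robin_root`). This
function is positive on the closed disk and constant on the boundary circle.

Upper bound for general Ω: transplant the ground state by F⁻¹ and use it as a trial function. The
Dirichlet integral does not increase, by conformal invariance. The boundary value is the constant
`bessel 0 T`, so the normalization α/L(Ω) cancels the length and the boundary term is at most α ·
(`bessel 0 T`)². The mass is the integral of the radial weight times |F'|². Since the cross term is
a radially weighted integral of a holomorphic function vanishing at 0, the mass splits as |F'(0)|²A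
+ B, with A = `radialMass T` and B = `nonlinearity T F` ≥ 0 (`integral_transplant_sq`). With the
energy identity `robin_energy_radial` this gives λ₁|F'(0)|² ≤ 4T · |F'(0)|²A / (|F'(0)|²A + B) ≤ 4T,
and equality forces B = 0, hence F' constant.

Value on disks: the matching lower bound comes from Picone's inequality on each ray, comparing an
arbitrary smooth function with the positive ground state (`picone_ray`). It is integrated over
angles, then extended to H¹ by the approximants in the definition of the trace. The length of a
circle is never computed: rotation invariance turns α/L times the boundary integral into α times the
circle average (`integral_sphere_hausdorffMeasure`).

The trace of the trial function needs no boundary extension of F. Since its values approach a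
constant from above, truncating them near that constant gives smooth functions on the plane
(`isTrace_const`). The Lipschitz boundary serves to make the length finite. -/

namespace Robin

/-! ### Inverses of injective holomorphic functions -/

/-- Open mapping theorem; its alternative, local constancy, contradicts injectivity. -/
theorem nhds_le_map_nhds_of_injOn {F : ℂ → ℂ} {U : Set ℂ} (hU : IsOpen U)
    (hF : DifferentiableOn ℂ F U) (hinj : Set.InjOn F U) {z : ℂ} (hz : z ∈ U) :
    𝓝 (F z) ≤ map F (𝓝 z) := by
  rcases (hF.analyticAt (hU.mem_nhds hz)).eventually_constant_or_nhds_le_map_nhds with h | h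
  · obtain ⟨w, hw, hwU, hwz⟩ : ∃ w, F w = F z ∧ w ∈ U ∧ w ≠ z := by
      have h1 : ∀ᶠ w in 𝓝[≠] z, F w = F z ∧ w ∈ U ∧ w ≠ z := by
        filter_upwards [nhdsWithin_le_nhds h, nhdsWithin_le_nhds (hU.mem_nhds hz),
          self_mem_nhdsWithin] with w h1 h2 h3 using ⟨h1, h2, h3⟩
      exact h1.exists
    exact absurd (hinj hwU hz hw) hwz
  · exact h

theorem continuousAt_invFunOn {F : ℂ → ℂ} {U : Set ℂ} (hU : IsOpen U)
    (hF : DifferentiableOn ℂ F U) (hinj : Set.InjOn F U) {z : ℂ} (hz : z ∈ U) :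
    ContinuousAt (Function.invFunOn F U) (F z) := by
  have hleft := hinj.leftInvOn_invFunOn
  rw [ContinuousAt, hleft hz]
  refine Tendsto.mono_left ?_ (nhds_le_map_nhds_of_injOn hU hF hinj hz)
  rw [tendsto_map'_iff]
  refine tendsto_id.congr' ?_
  filter_upwards [hU.mem_nhds hz] with w hw using (hleft hw).symm

theorem isOpen_image_of_injOn {F : ℂ → ℂ} {U : Set ℂ} (hU : IsOpen U)
    (hF : DifferentiableOn ℂ F U) (hinj : Set.InjOn F U) : IsOpen (F '' U) := by
  rw [isOpen_iff_mem_nhds]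
  rintro _ ⟨z, hz, rfl⟩
  exact nhds_le_map_nhds_of_injOn hU hF hinj hz (image_mem_map (hU.mem_nhds hz))

theorem hasDerivAt_invFunOn {F : ℂ → ℂ} {U : Set ℂ} (hU : IsOpen U)
    (hF : DifferentiableOn ℂ F U) (hinj : Set.InjOn F U) {z : ℂ} (hz : z ∈ U)
    (hd : deriv F z ≠ 0) :
    HasDerivAt (Function.invFunOn F U) (deriv F z)⁻¹ (F z) := by
  have hleft := hinj.leftInvOn_invFunOn
  have hO := isOpen_image_of_injOn hU hF hinj
  refine HasDerivAt.of_local_left_inverse (f := F) (continuousAt_invFunOn hU hF hinj hz) ?_ hd ?_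
  · rw [hleft hz]
    exact (hF.differentiableAt (hU.mem_nhds hz)).hasDerivAt
  · filter_upwards [hO.mem_nhds (Set.mem_image_of_mem F hz)] with w hw
    exact Function.invFunOn_eq hw

/-- An injective holomorphic function has nonvanishing derivative. -/
theorem deriv_ne_zero_of_injOn {F : ℂ → ℂ} {U : Set ℂ} (hU : IsOpen U)
    (hF : DifferentiableOn ℂ F U) (hinj : Set.InjOn F U) {z : ℂ} (hz : z ∈ U) :
    deriv F z ≠ 0 := by
  intro h0
  have hleft := hinj.leftInvOn_invFunOn
  have hO := isOpen_image_of_injOn hU hF hinj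
  have hA : AnalyticAt ℂ F z := hF.analyticAt (hU.mem_nhds hz)
  have hcont := continuousAt_invFunOn hU hF hinj hz
  -- Zeros of F' are isolated, as otherwise F would be constant near z.
  have hne : ∀ᶠ w in 𝓝[≠] z, deriv F w ≠ 0 := by
    rcases hA.deriv.eventually_eq_zero_or_eventually_ne_zero with h | h
    · exfalso
      obtain ⟨r, hr, hball⟩ := Metric.eventually_nhds_iff_ball.1 (h.and (hU.mem_nhds hz))
      have hconst : ∀ w ∈ Metric.ball z r, F w = F z := fun w hw =>
        Metric.isOpen_ball.is_const_of_deriv_eq_zero (convex_ball z r).isPreconnected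
          (hF.mono fun x hx => (hball x hx).2) (fun x hx => (hball x hx).1) hw
          (Metric.mem_ball_self hr)
      have h1 : ∀ᶠ w in 𝓝[≠] z, w ∈ Metric.ball z r ∧ w ≠ z := by
        filter_upwards [nhdsWithin_le_nhds (Metric.ball_mem_nhds z hr), self_mem_nhdsWithin]
          with w h1 h2 using ⟨h1, h2⟩
      obtain ⟨w, hw, hwz⟩ := h1.exists
      exact hwz (hinj (hball w hw).2 hz (hconst w hw))
    · exact h
  -- Removable singularity: the inverse is continuous at F z and holomorphic at nearby points, where
  -- F' does not vanish. The chain rule for the composite with F then yields 0 = 1.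
  have hdiff : DifferentiableAt ℂ (Function.invFunOn F U) (F z) := by
    refine (Complex.analyticAt_of_differentiable_on_punctured_nhds_of_continuousAt ?_
      hcont).differentiableAt
    have h1 : ∀ᶠ w in 𝓝 (F z), Function.invFunOn F U w ≠ z →
        deriv F (Function.invFunOn F U w) ≠ 0 := by
      have := eventually_nhdsWithin_iff.1 hne
      rw [← hleft hz] at this
      have h2 := hcont.eventually this
      filter_upwards [h2] with w hw hw2
      apply hw
      rw [hleft hz]; exact hw2
    filter_upwards [nhdsWithin_le_nhds h1, nhdsWithin_le_nhds
      (hO.mem_nhds (Set.mem_image_of_mem F hz)), self_mem_nhdsWithin] with w h1 h2 h3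
    obtain ⟨x, hx, rfl⟩ := h2
    rw [hleft hx] at h1
    refine (hasDerivAt_invFunOn hU hF hinj hx (h1 ?_)).differentiableAt
    rintro rfl
    exact h3 rfl
  have hcomp := hdiff.hasDerivAt.comp z (hF.differentiableAt (hU.mem_nhds hz)).hasDerivAt
  have hid : HasDerivAt (Function.invFunOn F U ∘ F) 1 z := by
    refine (hasDerivAt_id z).congr_of_eventuallyEq ?_
    filter_upwards [hU.mem_nhds hz] with w hw using hleft hw
  have := hcomp.unique hid
  rw [h0, mul_zero] at this
  exact zero_ne_one this

theorem differentiableOn_invFunOn {F : ℂ → ℂ} {U : Set ℂ} (hU : IsOpen U)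
    (hF : DifferentiableOn ℂ F U) (hinj : Set.InjOn F U) :
    DifferentiableOn ℂ (Function.invFunOn F U) (F '' U) := by
  rintro _ ⟨z, hz, rfl⟩
  exact (hasDerivAt_invFunOn hU hF hinj hz
    (deriv_ne_zero_of_injOn hU hF hinj hz)).differentiableAt.differentiableWithinAt

/-! ### Bessel functions -/

/-- The entire function `∑ (-t)ᵏ / (k! (k+m)!)`, that is, `t^{-m/2} J_m(2√t)`. -/
noncomputable def bessel (m : ℕ) (t : ℝ) : ℝ :=
  ∑' k : ℕ, (-1) ^ k * t ^ k / (k.factorial * (k + m).factorial)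

theorem norm_bessel_term_le (m k : ℕ) (t : ℝ) :
    ‖(-1 : ℝ) ^ k * t ^ k / (k.factorial * (k + m).factorial)‖ ≤ |t| ^ k / k.factorial := by
  have h1 : (1 : ℝ) ≤ (k + m).factorial := by exact_mod_cast Nat.factorial_pos _
  have h2 : (0 : ℝ) < k.factorial := by exact_mod_cast Nat.factorial_pos _
  rw [norm_div, norm_mul, norm_pow, norm_pow, norm_neg, norm_one, one_pow, one_mul,
    Real.norm_eq_abs, norm_mul, Real.norm_natCast, Real.norm_natCast]
  gcongr
  nlinarith

theorem summable_bessel (m : ℕ) (t : ℝ) :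
    Summable fun k : ℕ => (-1 : ℝ) ^ k * t ^ k / (k.factorial * (k + m).factorial) :=
  .of_norm_bounded (Real.summable_pow_div_factorial |t|) (norm_bessel_term_le m · t)

/-- Termwise differentiation on the ball of radius |t| + 1, dominated by the differentiated
exponential series; an index shift turns the result into the series of order m + 1. -/
theorem hasDerivAt_bessel (m : ℕ) (t : ℝ) : HasDerivAt (bessel m) (-bessel (m + 1) t) t := by
  set R : ℝ := |t| + 1
  have hR : 0 ≤ R := by positivity
  set u : ℕ → ℝ := fun k => k * R ^ (k - 1) / k.factorial
  have hu : Summable u := by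
    rw [← summable_nat_add_iff 1]
    refine (Real.summable_pow_div_factorial R).congr fun k => ?_
    have h2 : (k.factorial : ℝ) ≠ 0 := by exact_mod_cast (Nat.factorial_pos _).ne'
    simp only [u, Nat.factorial_succ, Nat.add_sub_cancel]
    push_cast
    field_simp
  have key := hasDerivAt_tsum_of_isPreconnected (y₀ := t) (y := t)
    (g := fun k t => (-1 : ℝ) ^ k * t ^ k / (k.factorial * (k + m).factorial))
    (g' := fun k t => (-1 : ℝ) ^ k * (k * t ^ (k - 1)) / (k.factorial * (k + m).factorial))
    hu (Metric.isOpen_ball (x := (0 : ℝ)) (ε := R)) (convex_ball _ _).isPreconnected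
    (fun k y _ => (((hasDerivAt_pow k y).const_mul _).div_const _)) ?_ (by simp [R])
    (summable_bessel m t) (by simp [R])
  · convert! key using 1
    have hs : Summable fun k => (-1 : ℝ) ^ k * (k * t ^ (k - 1)) /
        (k.factorial * (k + m).factorial) := by
      rw [← summable_nat_add_iff 1]
      refine (summable_bessel (m + 1) t).neg.congr fun k => ?_
      have h2 : (k.factorial : ℝ) ≠ 0 := by exact_mod_cast (Nat.factorial_pos _).ne'
      rw [show k + 1 + m = k + (m + 1) by ring]
      simp only [Nat.factorial_succ k, Nat.add_sub_cancel]
      push_cast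
      field_simp
      ring
    rw [hs.tsum_eq_zero_add, bessel, ← tsum_neg]
    simp only [Nat.cast_zero, zero_mul, mul_zero, zero_div, zero_add]
    refine tsum_congr fun k => ?_
    have h2 : (k.factorial : ℝ) ≠ 0 := by exact_mod_cast (Nat.factorial_pos _).ne'
    rw [show k + 1 + m = k + (m + 1) by ring]
    simp only [Nat.factorial_succ k, Nat.add_sub_cancel]
    push_cast
    field_simp
    ring
  · intro k y hy
    have hy' : |y| ≤ R := by simpa using (mem_ball_zero_iff.1 hy).le
    have h1 : (1 : ℝ) ≤ (k + m).factorial := by exact_mod_cast Nat.factorial_pos _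
    have h2 : (0 : ℝ) < k.factorial := by exact_mod_cast Nat.factorial_pos _
    simp only [u]
    rw [norm_div, norm_mul, norm_pow, norm_neg, norm_one, one_pow, one_mul, norm_mul, norm_pow,
      Real.norm_eq_abs y, norm_mul, Real.norm_natCast, Real.norm_natCast, Real.norm_natCast]
    gcongr
    nlinarith

theorem contDiff_bessel (m : ℕ) : ContDiff ℝ ∞ (bessel m) := by
  rw [contDiff_infty]
  intro n
  induction n generalizing m with
  | zero =>
    exact contDiff_zero.2
      (continuous_iff_continuousAt.2 fun t => (hasDerivAt_bessel m t).continuousAt)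
  | succ n ih =>
    rw [Nat.cast_add, Nat.cast_one, contDiff_succ_iff_deriv]
    refine ⟨fun t => (hasDerivAt_bessel m t).differentiableAt, by simp, ?_⟩
    rw [show deriv (bessel m) = fun t => -bessel (m + 1) t from
      funext fun t => (hasDerivAt_bessel m t).deriv]
    exact (ih (m + 1)).neg

/-- Coefficientwise this is 1/k!² − 1/(k!(k+1)!) = 1/((k−1)!(k+1)!). -/
theorem bessel_recurrence (t : ℝ) : bessel 0 t = bessel 1 t - t * bessel 2 t := by
  have hs := (summable_bessel 0 t).sub (summable_bessel 1 t)
  have h : bessel 0 t - bessel 1 t = -(t * bessel 2 t) := by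
    rw [bessel, bessel, bessel, ← (summable_bessel 0 t).tsum_sub (summable_bessel 1 t),
      hs.tsum_eq_zero_add, ← tsum_mul_left, ← tsum_neg]
    norm_num [Nat.factorial]
    refine tsum_congr fun k => ?_
    have h2 : (k.factorial : ℝ) ≠ 0 := by exact_mod_cast (Nat.factorial_pos _).ne'
    field_simp
    ring
  linarith

theorem bessel_at_zero (m : ℕ) : bessel m 0 = 1 / m.factorial := by
  rw [bessel, tsum_eq_single 0]
  · simp
  · intro k hk
    simp [hk]

/-- Places a zero of J₀ in range: the first four terms sum to −2/9, and (i+4)! ≥ 24·5ⁱ bounds the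
rest by a geometric series of sum 25/828. -/
theorem bessel_zero_two_neg : bessel 0 2 < 0 := by
  have hs := summable_bessel 0 2
  rw [bessel, ← hs.sum_add_tsum_nat_add 4]
  have htail : ∑' i : ℕ, (-1 : ℝ) ^ (i + 4) * 2 ^ (i + 4) /
      ((i + 4).factorial * (i + 4 + 0).factorial) ≤ ∑' i : ℕ, 1 / 36 * (2 / 25 : ℝ) ^ i := by
    refine ((summable_nat_add_iff 4).2 hs).tsum_le_tsum (fun i => ?_)
      ((summable_geometric_of_lt_one (by norm_num) (by norm_num)).mul_left _)
    have h1 : (24 * 5 ^ i : ℝ) ≤ (i + 4).factorial := by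
      have := Nat.factorial_mul_pow_le_factorial (m := 4) (n := i)
      rw [add_comm 4 i] at this
      exact_mod_cast this
    have h2 : (-1 : ℝ) ^ (i + 4) * 2 ^ (i + 4) ≤ 2 ^ (i + 4) := by
      have : (-1 : ℝ) ^ (i + 4) ≤ 1 := by
        rcases neg_one_pow_eq_or ℝ (i + 4) with h | h <;> norm_num [h]
      nlinarith [pow_pos (two_pos : (0 : ℝ) < 2) (i + 4)]
    calc _ ≤ (2 : ℝ) ^ (i + 4) / ((24 * 5 ^ i) * (24 * 5 ^ i)) := by
          rw [add_zero]; gcongr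
      _ = _ := by
          rw [div_pow, show (25 : ℝ) = 5 * 5 by norm_num, mul_pow, pow_add]
          field_simp
          norm_num
  rw [tsum_mul_left, tsum_geometric_of_lt_one (by norm_num) (by norm_num)] at htail
  have : ∑ i ∈ Finset.range 4, (-1 : ℝ) ^ i * 2 ^ i / (i.factorial * (i + 0).factorial)
      = -2 / 9 := by
    simp [Finset.sum_range_succ, Nat.factorial]
    norm_num
  rw [this]
  norm_num at htail ⊢
  linarith

/-- The radial eigenvalue equation (r u')' = −4T r u in the variable t = T r². -/
theorem hasDerivAt_mul_bessel_one (t : ℝ) :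
    HasDerivAt (fun t => t * bessel 1 t) (bessel 0 t) t := by
  convert! (hasDerivAt_id t).mul (hasDerivAt_bessel 1 t) using 1
  rw [bessel_recurrence]
  simp
  ring

/-- The first Robin eigenvalue of the unit disk, divided by four: `T = λ/4` solves the Robin
condition for the radial function `bessel 0 (T r²)`, which is positive on the disk. -/
theorem exists_robin_root {β : ℝ} (hβ : 0 < β) :
    ∃ T : ℝ, 0 < T ∧ β * bessel 0 T = 2 * T * bessel 1 T ∧
      (∀ t ∈ Set.Icc 0 T, 0 < bessel 0 t) ∧ ∀ t ∈ Set.Icc 0 T, 0 < bessel 1 t := by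
  have hc (m : ℕ) : Continuous (bessel m) := (contDiff_bessel m).continuous
  have h00 : bessel 0 0 = 1 := by simp [bessel_at_zero]
  have h10 : bessel 1 0 = 1 := by simp [bessel_at_zero]
  set S : Set ℝ := Set.Icc 0 2 ∩ bessel 0 ⁻¹' Set.Iic 0
  have hScl : IsCompact S := isCompact_Icc.inter_right (isClosed_Iic.preimage (hc 0))
  -- T₀ is the first point where `bessel 0` fails to be positive.
  obtain ⟨T₀, hT₀, hmin⟩ := hScl.exists_isLeast ⟨2, ⟨by norm_num, bessel_zero_two_neg.le⟩⟩
  have hT₀pos : 0 < T₀ := by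
    rcases hT₀.1.1.eq_or_lt with h | h
    · have := hT₀.2
      rw [← h, Set.mem_preimage, h00, Set.mem_Iic] at this
      linarith
    · exact h
  have hpos : ∀ t ∈ Set.Ico 0 T₀, 0 < bessel 0 t := by
    intro t ht
    by_contra! hle
    exact absurd (hmin ⟨⟨ht.1, ht.2.le.trans hT₀.1.2⟩, hle⟩) (not_le.2 ht.2)
  -- The derivative is `bessel 0`, positive before T₀; as the product vanishes at 0, `bessel 1` is
  -- positive up to T₀.
  have hmono : StrictMonoOn (fun t => t * bessel 1 t) (Set.Icc 0 T₀) := by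
    refine strictMonoOn_of_deriv_pos (convex_Icc _ _) (by have := hc 1; fun_prop) fun t ht => ?_
    rw [interior_Icc] at ht
    rw [(hasDerivAt_mul_bessel_one t).deriv]
    exact hpos t ⟨ht.1.le, ht.2⟩
  have hpos1 : ∀ t ∈ Set.Icc 0 T₀, 0 < bessel 1 t := by
    intro t ht
    rcases ht.1.eq_or_lt with h | h
    · rw [← h, h10]; norm_num
    · have := hmono ⟨le_rfl, hT₀pos.le⟩ ht h
      simp only [zero_mul] at this
      exact (mul_pos_iff_of_pos_left h).1 this
  -- The Robin defect is β > 0 at 0 and negative at T₀, so its root lies strictly before T₀, where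
  -- `bessel 0` is still positive.
  have hivt := intermediate_value_Icc' hT₀pos.le
    (f := fun t => β * bessel 0 t - 2 * t * bessel 1 t)
    (by have := hc 1; have := hc 0; fun_prop)
  have hneg : β * bessel 0 T₀ - 2 * T₀ * bessel 1 T₀ < 0 := by
    have h1 : bessel 0 T₀ ≤ 0 := hT₀.2
    have h2 := hpos1 T₀ ⟨hT₀pos.le, le_rfl⟩
    nlinarith [mul_pos hT₀pos h2, mul_nonneg hβ.le (neg_nonneg.2 h1)]
  obtain ⟨T, hT, hTe⟩ := hivt (show (0 : ℝ) ∈ _ from ⟨hneg.le, by simp [h00, hβ.le]⟩)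
  simp only at hTe
  have hTlt : T < T₀ := lt_of_le_of_ne hT.2 (by rintro rfl; exact hneg.ne hTe)
  have hTpos : 0 < T := lt_of_le_of_ne hT.1 (by rintro rfl; simp [h00] at hTe; exact hβ.ne' hTe)
  exact ⟨T, hTpos, by linarith, fun t ht => hpos t ⟨ht.1, ht.2.trans_lt hTlt⟩,
    fun t ht => hpos1 t ⟨ht.1, ht.2.trans hT.2⟩⟩

/-! ### Integration in polar coordinates on the unit disk -/

section Polar

variable {E : Type*} [NormedAddCommGroup E] [NormedSpace ℝ E]

theorem polarCoord_symm_eq_circleMap (p : ℝ × ℝ) :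
    Complex.polarCoord.symm p = circleMap 0 p.1 p.2 := by
  simp [Complex.polarCoord_symm_apply, circleMap, Complex.exp_mul_I]

theorem integral_ball_eq_integral_prod (f : ℂ → E) :
    ∫ z in Metric.ball (0 : ℂ) 1, f z =
      ∫ p in Set.Ioo (0 : ℝ) 1 ×ˢ Set.Ioo (-Real.pi) Real.pi, p.1 • f (circleMap 0 p.1 p.2) := by
  classical
  rw [← integral_indicator measurableSet_ball, ← Complex.integral_comp_polarCoord_symm,
    ← integral_indicator (by rw [polarCoord_target]; measurability),
    ← integral_indicator (by measurability)]
  congr 1 with p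
  simp only [polarCoord_symm_eq_circleMap, Set.indicator_apply, polarCoord_target, Set.mem_prod,
      Set.mem_Ioi, Set.mem_Ioo,
    mem_ball_zero_iff, norm_circleMap_zero]
  by_cases h0 : 0 < p.1
  · simp only [h0, true_and, abs_of_pos h0]
    split_ifs <;> simp_all
  · simp [h0]

theorem integrableOn_polar {f : ℂ → E} (hc : ContinuousOn f (Metric.ball 0 1))
    (hf : IntegrableOn f (Metric.ball 0 1)) :
    IntegrableOn (fun p : ℝ × ℝ => p.1 • f (circleMap 0 p.1 p.2))
      (Set.Ioo (0 : ℝ) 1 ×ˢ Set.Ioo (-Real.pi) Real.pi) := by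
  have hms : MeasurableSet (Set.Ioo (0 : ℝ) 1 ×ˢ Set.Ioo (-Real.pi) Real.pi) := by measurability
  classical
  refine ⟨?_, ?_⟩
  · refine ContinuousOn.aestronglyMeasurable ?_ hms
    refine continuousOn_fst.smul (hc.comp ?_ ?_)
    · simp only [circleMap]; fun_prop
    · rintro p ⟨hp, -⟩
      simpa [abs_of_pos hp.1] using hp.2
  · have h := hf.2
    rw [hasFiniteIntegral_iff_enorm, ← lintegral_indicator measurableSet_ball,
      ← Complex.lintegral_comp_polarCoord_symm,
      ← lintegral_indicator (by rw [polarCoord_target]; measurability)] at h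
    rw [hasFiniteIntegral_iff_enorm, ← lintegral_indicator hms]
    refine lt_of_le_of_lt (lintegral_mono fun p => ?_) h
    simp only [polarCoord_symm_eq_circleMap, Set.indicator_apply, polarCoord_target, Set.mem_prod,
      Set.mem_Ioi, Set.mem_Ioo,
      mem_ball_zero_iff, norm_circleMap_zero]
    by_cases h0 : 0 < p.1
    · simp only [h0, true_and, abs_of_pos h0]
      split_ifs <;> simp_all [enorm_smul, Real.enorm_of_nonneg h0.le]
    · simp [h0]

/-- Fubini with the angle outside: the order suited to inequalities along rays. -/
theorem integral_ball_eq_rays {f : ℂ → E} (hc : ContinuousOn f (Metric.ball 0 1))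
    (hf : IntegrableOn f (Metric.ball 0 1)) :
    ∫ z in Metric.ball (0 : ℂ) 1, f z =
      ∫ θ in Set.Ioo (-Real.pi) Real.pi, ∫ r in Set.Ioo (0 : ℝ) 1, r • f (circleMap 0 r θ) := by
  have h := integrableOn_polar hc hf
  rw [integral_ball_eq_integral_prod]
  rw [IntegrableOn, Measure.volume_eq_prod, ← Measure.prod_restrict] at h
  rw [Measure.volume_eq_prod, ← Measure.prod_restrict, integral_prod_symm _ h]

theorem integrable_rays {f : ℂ → E} (hc : ContinuousOn f (Metric.ball 0 1))
    (hf : IntegrableOn f (Metric.ball 0 1)) :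
    IntegrableOn (fun θ : ℝ => ∫ r in Set.Ioo (0 : ℝ) 1, r • f (circleMap 0 r θ))
      (Set.Ioo (-Real.pi) Real.pi) := by
  have h := integrableOn_polar hc hf
  rw [IntegrableOn, Measure.volume_eq_prod, ← Measure.prod_restrict] at h
  exact h.integral_prod_right

theorem integral_Ioo_circleMap (f : ℂ → E) (c : ℂ) (R : ℝ) :
    ∫ θ in Set.Ioo (-Real.pi) Real.pi, f (circleMap c R θ) =
      (2 * Real.pi) • Real.circleAverage f c R := by
  rw [Real.circleAverage, smul_inv_smul₀ (by positivity), ← integral_Ioc_eq_integral_Ioo,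
    ← intervalIntegral.integral_of_le (by linarith [Real.pi_pos])]
  have := ((periodic_circleMap c R).comp f).intervalIntegral_add_eq (-Real.pi) 0
  rw [show -Real.pi + 2 * Real.pi = Real.pi by ring, zero_add] at this
  exact this

/-- Fubini with the radius outside: the order suited to the mean value property and to radial
integrands. -/
theorem integral_ball_eq_circleAverage {f : ℂ → E} (hc : ContinuousOn f (Metric.ball 0 1))
    (hf : IntegrableOn f (Metric.ball 0 1)) :
    ∫ z in Metric.ball (0 : ℂ) 1, f z =
      ∫ r in Set.Ioo (0 : ℝ) 1, r • (2 * Real.pi) • Real.circleAverage f 0 r := by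
  have h := integrableOn_polar hc hf
  rw [integral_ball_eq_integral_prod]
  rw [IntegrableOn, Measure.volume_eq_prod, ← Measure.prod_restrict] at h
  rw [Measure.volume_eq_prod, ← Measure.prod_restrict, integral_prod _ h]
  congr 1 with r
  rw [integral_smul, integral_Ioo_circleMap]

end Polar

/-- A radially weighted integral of a holomorphic function over the disk only sees its value at
the centre. -/
theorem integral_ball_radial_mul_holomorphic {w : ℝ → ℝ} (hw : Continuous w) {g : ℂ → ℂ}
    (hg : DifferentiableOn ℂ g (Metric.ball 0 1))
    (hgi : IntegrableOn (fun z => w ‖z‖ • g z) (Metric.ball 0 1)) (h0 : g 0 = 0) :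
    ∫ z in Metric.ball (0 : ℂ) 1, w ‖z‖ • g z = 0 := by
  rw [integral_ball_eq_circleAverage (by have := hg.continuousOn; fun_prop) hgi]
  refine setIntegral_eq_zero_of_forall_eq_zero fun r hr => ?_
  have h1 : Real.circleAverage (fun z => w ‖z‖ • g z) 0 r = w r • Real.circleAverage g 0 r := by
    rw [← Real.circleAverage_smul]
    refine Real.circleAverage_congr_sphere fun z hz => ?_
    rw [mem_sphere_zero_iff_norm, abs_of_pos hr.1] at hz
    simp [hz]
  -- Mean value property; since r < 1 the closed disk of radius r stays inside the domain of
  -- holomorphy.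
  have h2 : Real.circleAverage g 0 r = g 0 := by
    refine DiffContOnCl.circleAverage (DifferentiableOn.diffContOnCl (hg.mono ?_))
    rw [abs_of_pos hr.1]
    exact Metric.closure_ball_subset_closedBall.trans (Metric.closedBall_subset_ball hr.2)
  rw [h1, h2, h0, smul_zero, smul_zero, smul_zero]

/-! ### Arclength on circles -/

/-- The circle lies in a Lipschitz image of a bounded interval. -/
theorem hausdorffMeasure_sphere_lt_top (c : ℂ) {R : ℝ} (hR : 0 < R) :
    (μH[1] : Measure ℂ) (Metric.sphere c R) < ⊤ := by
  have h : Metric.sphere c R ⊆ circleMap c R '' Set.Icc 0 (2 * Real.pi) := by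
    rw [← abs_of_pos hR, ← image_circleMap_Ioc, abs_of_pos hR]
    exact Set.image_mono Set.Ioc_subset_Icc_self
  refine lt_of_le_of_lt (measure_mono h) (lt_of_le_of_lt
    ((lipschitzWith_circleMap c R).hausdorffMeasure_image_le zero_le_one _) ?_)
  rw [hausdorffMeasure_real, Real.volume_Icc]
  exact ENNReal.mul_lt_top (by simp) ENNReal.ofReal_lt_top

/-- The real part is 1-Lipschitz and maps the circle over an interval of length 2R. -/
theorem hausdorffMeasure_sphere_pos (c : ℂ) {R : ℝ} (hR : 0 < R) :
    0 < (μH[1] : Measure ℂ) (Metric.sphere c R) := by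
  have hlip : LipschitzWith 1 Complex.re := by
    refine LipschitzWith.of_dist_le_mul fun x y => ?_
    rw [NNReal.coe_one, one_mul, Real.dist_eq, ← Complex.sub_re, dist_eq_norm]
    exact Complex.abs_re_le_norm _
  have h : Set.Icc (c.re - R) (c.re + R) ⊆ Complex.re '' Metric.sphere c R := by
    intro x hx
    have h1 : 0 ≤ R ^ 2 - (x - c.re) ^ 2 := by nlinarith [hx.1, hx.2]
    refine ⟨⟨x, c.im + √(R ^ 2 - (x - c.re) ^ 2)⟩, ?_, rfl⟩
    rw [mem_sphere_iff_norm, Complex.norm_eq_sqrt_sq_add_sq]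
    simp only [Complex.sub_re, Complex.sub_im, add_sub_cancel_left, Real.sq_sqrt h1]
    rw [add_sub_cancel, Real.sqrt_sq hR.le]
  have h2 := (measure_mono h).trans (hlip.hausdorffMeasure_image_le (d := 1) zero_le_one
    (Metric.sphere c R))
  rw [hausdorffMeasure_real, Real.volume_Icc] at h2
  refine lt_of_lt_of_le ?_ (h2.trans (by simp))
  simp only [ENNReal.ofReal_pos]
  linarith

/-- The rotation by the angle `t` around `c`. -/
noncomputable def rotationAround (c : ℂ) (t : ℝ) : ℂ ≃ᵢ ℂ :=
  (IsometryEquiv.subRight c).trans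
    ((rotation (Circle.exp t)).toIsometryEquiv.trans (IsometryEquiv.addRight c))

theorem rotationAround_apply (c z : ℂ) (t : ℝ) :
    rotationAround c t z = Complex.exp (t * Complex.I) * (z - c) + c := by
  simp [rotationAround, rotation_apply]

/-- Hausdorff measure is rotation invariant: averaging the integral over all rotations leaves it
unchanged, and after Fubini the inner integral is the circle average at every point of the circle.
-/
theorem integral_sphere_hausdorffMeasure (c : ℂ) {R : ℝ} (hR : 0 < R) {f : ℂ → ℝ}
    (hf : Continuous f) :
    ∫ z in Metric.sphere c R, f z ∂μH[1] =
      ((μH[1] : Measure ℂ) (Metric.sphere c R)).toReal * Real.circleAverage f c R := by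
  have hfin := hausdorffMeasure_sphere_lt_top c hR
  set μ : Measure ℂ := (μH[1] : Measure ℂ).restrict (Metric.sphere c R) with hμ
  have : IsFiniteMeasure μ := ⟨by rwa [hμ, Measure.restrict_apply_univ]⟩
  have hmem (t : ℝ) {z : ℂ} (hz : z ∈ Metric.sphere c R) :
      rotationAround c t z ∈ Metric.sphere c R := by
    rw [mem_sphere_iff_norm] at hz ⊢
    rw [rotationAround_apply, add_sub_cancel_right, norm_mul, Complex.norm_exp_ofReal_mul_I,
      one_mul, hz]
  have hrot (t : ℝ) : ∫ z, f (rotationAround c t z) ∂μ = ∫ z, f z ∂μ := by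
    have h := ((rotationAround c t).measurePreserving_hausdorffMeasure 1).setIntegral_preimage_emb
      (rotationAround c t).toHomeomorph.measurableEmbedding f (Metric.sphere c R)
    rw [(rotationAround c t).preimage_sphere] at h
    convert! h using 4
    rw [IsometryEquiv.eq_symm_apply, rotationAround_apply]
    simp
  obtain ⟨M, hM⟩ := (isCompact_sphere c R).exists_bound_of_continuousOn hf.continuousOn
  have hcont : Continuous fun p : ℝ × ℂ => f (rotationAround c p.1 p.2) := by
    simp only [rotationAround_apply]
    fun_prop
  have hint : Integrable (Function.uncurry fun (t : ℝ) (z : ℂ) => f (rotationAround c t z))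
      ((volume.restrict (Set.Ioo (-Real.pi) Real.pi)).prod μ) := by
    refine Integrable.of_bound hcont.aestronglyMeasurable M ?_
    have h1 : ∀ᵐ z ∂μ, z ∈ Metric.sphere c R := ae_restrict_mem Metric.isClosed_sphere.measurableSet
    have h2 := (Measure.quasiMeasurePreserving_snd
      (μ := volume.restrict (Set.Ioo (-Real.pi) Real.pi)) (ν := μ)).ae h1
    filter_upwards [h2] with p hp using hM _ (hmem _ hp)
  have hswap := integral_integral_swap hint
  simp only [hrot] at hswap
  have hinner : ∀ z ∈ Metric.sphere c R, ∫ t in Set.Ioo (-Real.pi) Real.pi,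
      f (rotationAround c t z) = 2 * Real.pi * Real.circleAverage f c R := by
    intro z hz
    obtain ⟨θ, -, rfl⟩ : z ∈ circleMap c R '' Set.Ioc 0 (2 * Real.pi) := by
      rw [image_circleMap_Ioc, abs_of_pos hR]; exact hz
    have h1 : ∀ t : ℝ, rotationAround c t (circleMap c R θ) = circleMap c R (t + θ) := by
      intro t
      rw [rotationAround_apply]
      simp only [circleMap, Complex.ofReal_add, add_mul, Complex.exp_add]
      ring
    simp only [h1]
    have h2 := integral_Ioo_circleMap f c R
    rw [smul_eq_mul] at h2
    rw [← h2, ← integral_Ioc_eq_integral_Ioo, ← integral_Ioc_eq_integral_Ioo,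
      ← intervalIntegral.integral_of_le (by linarith [Real.pi_pos]),
      ← intervalIntegral.integral_of_le (by linarith [Real.pi_pos]),
      intervalIntegral.integral_comp_add_right (fun t => f (circleMap c R t))]
    have := ((periodic_circleMap c R).comp f).intervalIntegral_add_eq (-Real.pi + θ) (-Real.pi)
    rw [show -Real.pi + θ + 2 * Real.pi = Real.pi + θ by ring,
      show -Real.pi + 2 * Real.pi = Real.pi by ring] at this
    exact this
  rw [hμ, setIntegral_congr_fun Metric.isClosed_sphere.measurableSet hinner, ← hμ] at hswap
  simp only [integral_const, smul_eq_mul, measureReal_restrict_apply_univ, Real.volume_real_Ioo]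
    at hswap
  rw [max_eq_left (by linarith [Real.pi_pos])] at hswap
  have h3 : μ.real Set.univ = ((μH[1] : Measure ℂ) (Metric.sphere c R)).toReal := by
    rw [hμ, measureReal_restrict_apply_univ]; rfl
  rw [h3] at hswap
  have hpi := Real.pi_pos
  have : 2 * Real.pi * (∫ z, f z ∂μ) = 2 * Real.pi *
      (((μH[1] : Measure ℂ) (Metric.sphere c R)).toReal * Real.circleAverage f c R) := by
    linear_combination hswap
  exact mul_left_cancel₀ (by positivity) this

/-! ### Change of variables and convergence in `L²` -/

/-- The determinant of multiplication by `a` is the algebra norm of ℂ over ℝ. -/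
theorem det_restrictScalars_toSpanSingleton (a : ℂ) :
    ((ContinuousLinearMap.toSpanSingleton ℂ a).restrictScalars ℝ).det = ‖a‖ ^ 2 := by
  rw [← Complex.normSq_eq_norm_sq, ← Algebra.norm_complex_apply, Algebra.norm_apply]
  change LinearMap.det _ = _
  congr 1
  ext x
  simp [mul_comm]

/-- Change of variables by an injective holomorphic map. -/
theorem integral_image_of_injOn_holomorphic {E : Type*} [NormedAddCommGroup E] [NormedSpace ℝ E]
    {F : ℂ → ℂ} {U : Set ℂ} (hU : IsOpen U) (hF : DifferentiableOn ℂ F U)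
    (hinj : Set.InjOn F U) (g : ℂ → E) :
    ∫ w in F '' U, g w = ∫ z in U, ‖deriv F z‖ ^ 2 • g (F z) := by
  have h (z) (hz : z ∈ U) := ((hF.differentiableAt
    (hU.mem_nhds hz)).hasDerivAt.hasFDerivAt.restrictScalars ℝ).hasFDerivWithinAt (s := U)
  rw [integral_image_eq_integral_abs_det_fderiv_smul volume hU.measurableSet h hinj]
  refine setIntegral_congr_fun hU.measurableSet fun z _ => ?_
  simp only [det_restrictScalars_toSpanSingleton, abs_of_nonneg (sq_nonneg ‖deriv F z‖)]

theorem integrableOn_image_of_injOn_holomorphic {E : Type*} [NormedAddCommGroup E]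
    [NormedSpace ℝ E] {F : ℂ → ℂ} {U : Set ℂ} (hU : IsOpen U) (hF : DifferentiableOn ℂ F U)
    (hinj : Set.InjOn F U) (g : ℂ → E) :
    IntegrableOn g (F '' U) ↔ IntegrableOn (fun z => ‖deriv F z‖ ^ 2 • g (F z)) U := by
  have h (z) (hz : z ∈ U) := ((hF.differentiableAt
    (hU.mem_nhds hz)).hasDerivAt.hasFDerivAt.restrictScalars ℝ).hasFDerivWithinAt (s := U)
  rw [integrableOn_image_iff_integrableOn_abs_det_fderiv_smul volume hU.measurableSet h hinj]
  simp only [det_restrictScalars_toSpanSingleton, abs_of_nonneg (sq_nonneg ‖deriv F _‖)]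

theorem integral_norm_sq_eq_eLpNorm {X E : Type*} [MeasurableSpace X] {μ : Measure X}
    [NormedAddCommGroup E] {f : X → E} (hf : MemLp f 2 μ) :
    ∫ x, ‖f x‖ ^ 2 ∂μ = (eLpNorm f 2 μ).toReal ^ 2 := by
  have h0 : 0 ≤ ∫ x, ‖f x‖ ^ 2 ∂μ := integral_nonneg fun x => by positivity
  rw [hf.eLpNorm_eq_integral_rpow_norm two_ne_zero ENNReal.ofNat_ne_top]
  simp only [ENNReal.toReal_ofNat, Real.rpow_two]
  rw [ENNReal.toReal_ofReal (by positivity), ← Real.rpow_natCast, ← Real.rpow_mul h0]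
  norm_num

theorem tendsto_integral_norm_sq {X E : Type*} [MeasurableSpace X] {μ : Measure X}
    [NormedAddCommGroup E] {f : ℕ → X → E} {g : X → E} (hf : ∀ n, MemLp (f n) 2 μ)
    (hg : MemLp g 2 μ)
    (h : Tendsto (fun n => eLpNorm (fun x => f n x - g x) 2 μ) atTop (𝓝 0)) :
    Tendsto (fun n => ∫ x, ‖f n x‖ ^ 2 ∂μ) atTop (𝓝 (∫ x, ‖g x‖ ^ 2 ∂μ)) := by
  simp only [integral_norm_sq_eq_eLpNorm (hf _), integral_norm_sq_eq_eLpNorm hg]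
  have h1 := ((Lp.tendsto_Lp_iff_tendsto_eLpNorm'' f hf g hg).2 h).norm
  simp only [Lp.norm_toLp] at h1
  exact h1.pow 2

/-! ### The Robin problem on the disk -/

theorem hasDerivAt_bessel_mul_sq (m : ℕ) (T r : ℝ) :
    HasDerivAt (fun r => bessel m (T * r ^ 2)) (-bessel (m + 1) (T * r ^ 2) * (2 * T * r)) r := by
  have h : HasDerivAt (fun r : ℝ => T * r ^ 2) (2 * T * r) r := by
    convert! (hasDerivAt_pow 2 r).const_mul T using 1
    simp; ring
  exact (hasDerivAt_bessel m (T * r ^ 2)).comp r h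

theorem continuous_bessel (m : ℕ) : Continuous (bessel m) := (contDiff_bessel m).continuous

theorem integral_Ioo_eq_sub_of_hasDerivAt {f f' : ℝ → ℝ} {a b : ℝ} (hab : a ≤ b)
    (h : ∀ x ∈ Set.Icc a b, HasDerivAt f (f' x) x) (hc : ContinuousOn f' (Set.Icc a b)) :
    ∫ x in Set.Ioo a b, f' x = f b - f a := by
  rw [← integral_Ioc_eq_integral_Ioo, ← intervalIntegral.integral_of_le hab]
  rw [← Set.uIcc_of_le hab] at h hc
  exact intervalIntegral.integral_eq_sub_of_hasDerivAt h hc.intervalIntegrable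

/-- Picone's inequality along a ray. -/
theorem picone_ray {T β : ℝ} (hT : 0 < T) (hβ : β * bessel 0 T = 2 * T * bessel 1 T)
    (hpos : ∀ t ∈ Set.Icc 0 T, 0 < bessel 0 t) {p p' G : ℝ → ℝ}
    (hp : ∀ r, HasDerivAt p (p' r) r) (hp' : Continuous p') (hG : Continuous G)
    (hle : ∀ r, |p' r| ≤ G r) :
    -β * p 1 ^ 2 ≤ ∫ r in Set.Ioo (0 : ℝ) 1, r * (G r ^ 2 - 4 * T * p r ^ 2) := by
  have hpc : Continuous p := continuous_iff_continuousAt.2 fun r => (hp r).continuousAt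
  have hmem : ∀ r ∈ Set.Icc (0 : ℝ) 1, T * r ^ 2 ∈ Set.Icc 0 T := fun r hr =>
    ⟨by positivity, mul_le_of_le_one_right hT.le (pow_le_one₀ hr.1 hr.2)⟩
  have hne : ∀ r ∈ Set.Icc (0 : ℝ) 1, bessel 0 (T * r ^ 2) ≠ 0 := fun r hr =>
    (hpos _ (hmem r hr)).ne'
  -- With u the ground state, −u'/u = 2T r ρ.
  set ρ : ℝ → ℝ := fun r => bessel 1 (T * r ^ 2) / bessel 0 (T * r ^ 2) with hρ
  -- The derivative of r p² u'/u, simplified by the radial equation. Its primitive vanishes at 0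
  -- and, by the Robin condition, equals −β p(1)² at 1.
  set D : ℝ → ℝ := fun r => -(2 * p r * p' r * (2 * T * r ^ 2 * ρ r) +
    p r ^ 2 * (4 * T * r * (1 + T * r ^ 2 * ρ r ^ 2))) with hD
  have hb0 := continuous_bessel 0
  have hb1 := continuous_bessel 1
  have hρc : ContinuousOn ρ (Set.Icc 0 1) :=
    ContinuousOn.div (by fun_prop) (by fun_prop) hne
  have hder : ∀ r ∈ Set.Icc (0 : ℝ) 1,
      HasDerivAt (fun r => -(p r ^ 2 * (2 * T * r ^ 2 * ρ r))) (D r) r := by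
    intro r hr
    have h1 : HasDerivAt (fun r => 2 * (T * r ^ 2 * bessel 1 (T * r ^ 2)))
        (2 * (bessel 0 (T * r ^ 2) * (2 * T * r))) r := by
      have h : HasDerivAt (fun r : ℝ => T * r ^ 2) (2 * T * r) r := by
        convert! (hasDerivAt_pow 2 r).const_mul T using 1
        simp; ring
      exact ((hasDerivAt_mul_bessel_one (T * r ^ 2)).comp r h).const_mul 2
    have h2 := ((hp r).pow 2).mul (h1.div (hasDerivAt_bessel_mul_sq 0 T r) (hne r hr))
    convert! h2.neg using 1
    · ext x
      simp only [hρ, Pi.neg_apply, Pi.mul_apply, Pi.pow_apply, Pi.div_apply]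
      ring
    · simp only [hD, hρ]
      have := hne r hr
      simp
      field_simp
      ring
  have hDc : ContinuousOn D (Set.Icc 0 1) := by fun_prop
  have hint := integral_Ioo_eq_sub_of_hasDerivAt zero_le_one hder hDc
  have hρ1 : 2 * T * ρ 1 = β := by
    have := hne 1 ⟨zero_le_one, le_rfl⟩
    simp only [hρ, one_pow, mul_one] at this ⊢
    field_simp
    linarith
  have h1 : -β * p 1 ^ 2 = ∫ x in Set.Ioo (0 : ℝ) 1, D x := by
    rw [hint, ← hρ1]
    simp
    ring
  rw [h1]
  refine setIntegral_mono_on ((hDc.integrableOn_Icc).mono_set Set.Ioo_subset_Icc_self) ?_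
    measurableSet_Ioo fun r hr => ?_
  · refine IntegrableOn.mono_set (ContinuousOn.integrableOn_Icc ?_) Set.Ioo_subset_Icc_self
    fun_prop
  · have h2 : p' r ^ 2 ≤ G r ^ 2 := by
      rw [← sq_abs]; exact pow_le_pow_left₀ (abs_nonneg _) (hle r) 2
    have h3 := mul_le_mul_of_nonneg_left h2 hr.1.le
    -- Picone's identity: the integrand minus D is r(G² − p'²) + r(p' + 2T r ρ p)².
    have h4 := mul_nonneg hr.1.le (sq_nonneg (p' r + 2 * T * r * ρ r * p r))
    simp only [hD]
    nlinarith

theorem norm_gradient_eq_norm_fderiv (f : ℂ → ℝ) (z : ℂ) : ‖gradient f z‖ = ‖fderiv ℝ f z‖ := by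
  rw [gradient, LinearIsometryEquiv.norm_map]

theorem continuous_gradient {f : ℂ → ℝ} (hf : ContDiff ℝ ∞ f) : Continuous (gradient f) := by
  have := hf.continuous_fderiv (by simp)
  exact (LinearIsometryEquiv.continuous _).comp this

theorem integrableOn_ball_of_continuous {E : Type*} [NormedAddCommGroup E] {f : ℂ → E}
    (hf : Continuous f) (c : ℂ) (R : ℝ) : IntegrableOn f (Metric.ball c R) :=
  (hf.continuousOn.integrableOn_compact (isCompact_closedBall c R)).mono_set
    Metric.ball_subset_closedBall

/-- The sharp Robin inequality for smooth functions on the unit disk. -/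
theorem robin_inequality_disk {T α : ℝ} (hT : 0 < T)
    (hα : α / (2 * Real.pi) * bessel 0 T = 2 * T * bessel 1 T)
    (hpos : ∀ t ∈ Set.Icc 0 T, 0 < bessel 0 t) {f : ℂ → ℝ} (hf : ContDiff ℝ ∞ f) :
    4 * T * ∫ z in Metric.ball (0 : ℂ) 1, f z ^ 2 ≤
      (∫ z in Metric.ball (0 : ℂ) 1, ‖gradient f z‖ ^ 2) +
        α * Real.circleAverage (fun z => f z ^ 2) 0 1 := by
  have hfc := hf.continuous
  have hgc := continuous_gradient hf
  have hc : Continuous fun z => ‖gradient f z‖ ^ 2 - 4 * T * f z ^ 2 := by fun_prop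
  have hi := integrableOn_ball_of_continuous hc 0 1
  have h1 := integral_ball_eq_rays hc.continuousOn hi
  have h2 : ∀ θ : ℝ, -(α / (2 * Real.pi)) * f (circleMap 0 1 θ) ^ 2 ≤
      ∫ r in Set.Ioo (0 : ℝ) 1, r • (‖gradient f (circleMap 0 r θ)‖ ^ 2 -
        4 * T * f (circleMap 0 r θ) ^ 2) := by
    intro θ
    have hcm : Continuous fun r : ℝ => circleMap 0 r θ := by simp only [circleMap]; fun_prop
    have hcd : ∀ r : ℝ, HasDerivAt (fun r : ℝ => circleMap 0 r θ)
        (Complex.exp (θ * Complex.I)) r := by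
      intro r
      simp only [circleMap, zero_add]
      simpa using (Complex.ofRealCLM.hasDerivAt (x := r)).mul_const (Complex.exp (θ * Complex.I))
    -- On a ray, p' is the radial derivative, bounded by the full gradient.
    refine picone_ray hT hα hpos (p := fun r => f (circleMap 0 r θ))
      (p' := fun r => fderiv ℝ f (circleMap 0 r θ) (Complex.exp (θ * Complex.I)))
      (G := fun r => ‖gradient f (circleMap 0 r θ)‖) (fun r => ?_) ?_ (by fun_prop) fun r => ?_
    · exact ((hf.differentiable (by simp)) _).hasFDerivAt.comp_hasDerivAt r (hcd r)
    · have := hf.continuous_fderiv (by simp)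
      fun_prop
    · rw [norm_gradient_eq_norm_fderiv]
      refine ((fderiv ℝ f (circleMap 0 r θ)).le_opNorm _).trans ?_
      rw [Complex.norm_exp_ofReal_mul_I, mul_one]
  have hsq : Continuous fun z => f z ^ 2 := by fun_prop
  have h3 : ∫ θ in Set.Ioo (-Real.pi) Real.pi, -(α / (2 * Real.pi)) * f (circleMap 0 1 θ) ^ 2 =
      -(α * Real.circleAverage (fun z => f z ^ 2) 0 1) := by
    rw [integral_const_mul, integral_Ioo_circleMap (fun z => f z ^ 2)]
    have := Real.pi_pos
    simp only [smul_eq_mul]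
    field_simp
  have h4 := setIntegral_mono_on (s := Set.Ioo (-Real.pi) Real.pi) (IntegrableOn.mono_set
    (ContinuousOn.integrableOn_Icc (by fun_prop)) Set.Ioo_subset_Icc_self)
    (integrable_rays hc.continuousOn hi) measurableSet_Ioo (fun θ _ => h2 θ)
  rw [h3, ← h1, integral_sub (integrableOn_ball_of_continuous (by fun_prop) 0 1)
    (integrableOn_ball_of_continuous (by fun_prop) 0 1), integral_const_mul] at h4
  linarith

/-- The Robin energy identity for the radial eigenfunction `bessel 0 (T |z|²)`. -/
theorem robin_energy_radial {T α : ℝ}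
    (hα : α / (2 * Real.pi) * bessel 0 T = 2 * T * bessel 1 T) :
    (∫ z in Metric.ball (0 : ℂ) 1, (2 * T * ‖z‖ * bessel 1 (T * ‖z‖ ^ 2)) ^ 2) +
      α * bessel 0 T ^ 2 = 4 * T * ∫ z in Metric.ball (0 : ℂ) 1, bessel 0 (T * ‖z‖ ^ 2) ^ 2 := by
  have hb0 := continuous_bessel 0
  have hb1 := continuous_bessel 1
  have hc : Continuous fun z : ℂ => (2 * T * ‖z‖ * bessel 1 (T * ‖z‖ ^ 2)) ^ 2 -
    4 * T * bessel 0 (T * ‖z‖ ^ 2) ^ 2 := by fun_prop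
  have h1 := integral_ball_eq_circleAverage hc.continuousOn (integrableOn_ball_of_continuous hc 0 1)
  set D : ℝ → ℝ := fun r => 2 * Real.pi * (r * ((2 * T * r * bessel 1 (T * r ^ 2)) ^ 2 -
    4 * T * bessel 0 (T * r ^ 2) ^ 2)) with hD
  have h2 : ∫ r in Set.Ioo (0 : ℝ) 1, D r = -(α * bessel 0 T ^ 2) := by
    -- The primitive is 2π r u u', since (r u u')' = r u'² − 4T r u².
    have hder : ∀ r ∈ Set.Icc (0 : ℝ) 1, HasDerivAt (fun r => 2 * Real.pi *
        -(2 * (T * r ^ 2 * bessel 1 (T * r ^ 2)) * bessel 0 (T * r ^ 2))) (D r) r := by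
      intro r _
      have h : HasDerivAt (fun r : ℝ => T * r ^ 2) (2 * T * r) r := by
        convert! (hasDerivAt_pow 2 r).const_mul T using 1
        simp; ring
      have h1 := ((hasDerivAt_mul_bessel_one (T * r ^ 2)).comp r h).const_mul 2
      convert! ((h1.mul (hasDerivAt_bessel_mul_sq 0 T r)).neg).const_mul (2 * Real.pi) using 1
      simp [hD]
      ring
    rw [integral_Ioo_eq_sub_of_hasDerivAt zero_le_one hder (by fun_prop)]
    have := Real.pi_pos
    field_simp at hα
    simp
    linear_combination -bessel 0 T * hα
  have h3 : ∫ z in Metric.ball (0 : ℂ) 1, ((2 * T * ‖z‖ * bessel 1 (T * ‖z‖ ^ 2)) ^ 2 -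
      4 * T * bessel 0 (T * ‖z‖ ^ 2) ^ 2) = -(α * bessel 0 T ^ 2) := by
    rw [h1, ← h2]
    refine setIntegral_congr_fun measurableSet_Ioo fun r hr => ?_
    rw [Real.circleAverage_const_on_circle (a := (2 * T * r * bessel 1 (T * r ^ 2)) ^ 2 -
      4 * T * bessel 0 (T * r ^ 2) ^ 2)]
    · simp only [hD, smul_eq_mul]
      ring
    · intro z hz
      rw [mem_sphere_zero_iff_norm, abs_of_pos hr.1] at hz
      simp only [hz]
  rw [integral_sub (integrableOn_ball_of_continuous (by fun_prop) 0 1)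
    (integrableOn_ball_of_continuous (by fun_prop) 0 1), integral_const_mul] at h3
  linarith

theorem affine_image_ball (a b : ℂ) (ha : a ≠ 0) :
    (fun z => a * z + b) '' Metric.ball 0 1 = Metric.ball b ‖a‖ := by
  ext w
  constructor
  · rintro ⟨z, hz, rfl⟩
    rw [mem_ball_zero_iff] at hz
    rw [mem_ball_iff_norm, add_sub_cancel_right, norm_mul]
    exact mul_lt_of_lt_one_right (norm_pos_iff.2 ha) hz
  · intro hw
    rw [mem_ball_iff_norm] at hw
    refine ⟨(w - b) / a, ?_, by field_simp; ring⟩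
    rw [mem_ball_zero_iff, norm_div, div_lt_one (norm_pos_iff.2 ha)]
    exact hw

theorem affine_injOn {a : ℂ} (b : ℂ) (ha : a ≠ 0) (U : Set ℂ) :
    Set.InjOn (fun z => a * z + b) U := fun x _ y _ h => by
  simpa [ha] using h

theorem deriv_affine (a b z : ℂ) : deriv (fun z => a * z + b) z = a := by
  simp [deriv_add_const]

theorem integral_ball_affine (f : ℂ → ℝ) (c : ℂ) {R : ℝ} (hR : 0 < R) :
    ∫ z in Metric.ball c R, f z = R ^ 2 * ∫ z in Metric.ball (0 : ℂ) 1, f (R * z + c) := by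
  have hR' : (R : ℂ) ≠ 0 := by exact_mod_cast hR.ne'
  have h := integral_image_of_injOn_holomorphic (F := fun z => R * z + c) Metric.isOpen_ball
    (by fun_prop) (affine_injOn c hR' (Metric.ball 0 1)) f
  rw [affine_image_ball _ _ hR', Complex.norm_real, Real.norm_of_nonneg hR.le] at h
  rw [h]
  simp only [deriv_affine, Complex.norm_real, Real.norm_of_nonneg hR.le, smul_eq_mul]
  rw [integral_const_mul]

/-- The sharp Robin inequality for smooth functions on a disk. -/
theorem robin_inequality_ball {T α : ℝ} (hT : 0 < T)
    (hα : α / (2 * Real.pi) * bessel 0 T = 2 * T * bessel 1 T)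
    (hpos : ∀ t ∈ Set.Icc 0 T, 0 < bessel 0 t) (c : ℂ) {R : ℝ} (hR : 0 < R) {f : ℂ → ℝ}
    (hf : ContDiff ℝ ∞ f) :
    4 * T / R ^ 2 * ∫ z in Metric.ball c R, f z ^ 2 ≤
      (∫ z in Metric.ball c R, ‖gradient f z‖ ^ 2) +
        α * Real.circleAverage (fun z => f z ^ 2) c R := by
  set φ : ℂ → ℝ := fun z => f (R * z + c) with hφ
  have hφs : ContDiff ℝ ∞ φ := hf.comp (by fun_prop)
  have h := robin_inequality_disk hT hα hpos hφs
  have hgrad (z : ℂ) : ‖gradient φ z‖ = R * ‖gradient f (R * z + c)‖ := by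
    have h1 : HasFDerivAt (fun z : ℂ => R * z + c) (R • ContinuousLinearMap.id ℝ ℂ) z := by
      simpa using ((hasFDerivAt_id (𝕜 := ℝ) z).const_smul R).add_const c
    have h2 := ((hf.differentiable (by simp)) (R * z + c)).hasFDerivAt.comp z h1
    rw [norm_gradient_eq_norm_fderiv, norm_gradient_eq_norm_fderiv]
    rw [show fderiv ℝ φ z = _ from h2.fderiv, ContinuousLinearMap.comp_smul,
      ContinuousLinearMap.comp_id, norm_smul, Real.norm_of_nonneg hR.le]
  -- In the plane a dilation preserves the Dirichlet integral and the circle average while the mass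
  -- gains R²; hence 4T/R² with α unchanged.
  simp only [hgrad, mul_pow] at h
  rw [integral_const_mul] at h
  rw [integral_ball_affine _ c hR, integral_ball_affine _ c hR,
    Real.circleAverage_eq_circleAverage_zero_one]
  refine le_trans (le_of_eq ?_) h
  field_simp
  rfl

theorem frontier_ball_eq (c : ℂ) {R : ℝ} (hR : 0 < R) :
    frontier (Metric.ball c R) = Metric.sphere c R := frontier_ball c hR.ne'

theorem arclength_ball (c : ℂ) {R : ℝ} (hR : 0 < R) :
    arclength (Metric.ball c R) = (μH[1] : Measure ℂ).restrict (Metric.sphere c R) := by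
  rw [arclength, frontier_ball_eq c hR]

theorem perimeter_ball_pos (c : ℂ) {R : ℝ} (hR : 0 < R) : 0 < perimeter (Metric.ball c R) := by
  rw [perimeter, frontier_ball_eq c hR]
  exact ENNReal.toReal_pos (hausdorffMeasure_sphere_pos c hR).ne'
    (hausdorffMeasure_sphere_lt_top c hR).ne

theorem integral_arclength_ball (c : ℂ) {R : ℝ} (hR : 0 < R) {f : ℂ → ℝ} (hf : Continuous f) :
    ∫ z, f z ∂arclength (Metric.ball c R) =
      perimeter (Metric.ball c R) * Real.circleAverage f c R := by
  rw [arclength_ball c hR, integral_sphere_hausdorffMeasure c hR hf, perimeter,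
    frontier_ball_eq c hR]

theorem memLp_restrict_of_continuous {E : Type*} [NormedAddCommGroup E]
    {μ : Measure ℂ} {s K : Set ℂ} (hs : MeasurableSet s) (hK : IsCompact K) (hsK : s ⊆ K)
    (hμ : μ s < ⊤) {f : ℂ → E} (hf : Continuous f) :
    MemLp f 2 (μ.restrict s) := by
  have : IsFiniteMeasure (μ.restrict s) := ⟨by rwa [Measure.restrict_apply_univ]⟩
  obtain ⟨M, hM⟩ := hK.exists_bound_of_continuousOn hf.continuousOn
  refine MemLp.of_bound ?_ M ?_
  · exact hf.aestronglyMeasurable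
  · filter_upwards [ae_restrict_mem hs] with z hz using hM z (hsK hz)

/-- All three quadratic terms converge along the smooth approximants of the trace, so the smooth
inequality passes to the limit. -/
theorem robin_inequality_of_isTrace {T α : ℝ} (hT : 0 < T)
    (hα : α / (2 * Real.pi) * bessel 0 T = 2 * T * bessel 1 T)
    (hpos : ∀ t ∈ Set.Icc 0 T, 0 < bessel 0 t) (c : ℂ) {R : ℝ} (hR : 0 < R) {u : ℂ → ℝ}
    {G : ℂ → ℂ} {g : ℂ → ℝ} (hu : MemH1 (Metric.ball c R) u G)
    (hg : IsTrace (Metric.ball c R) u G g) :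
    4 * T / R ^ 2 * ∫ z in Metric.ball c R, u z ^ 2 ≤
      (∫ z in Metric.ball c R, ‖G z‖ ^ 2) + α / perimeter (Metric.ball c R) *
        ∫ z, g z ^ 2 ∂arclength (Metric.ball c R) := by
  obtain ⟨hgL, φ, hφ, h1, h2, h3⟩ := hg
  have hK := isCompact_closedBall c R
  have hsub : Metric.ball c R ⊆ Metric.closedBall c R := Metric.ball_subset_closedBall
  have hfin : volume (Metric.ball c R) < ⊤ := measure_ball_lt_top
  have m1 := tendsto_integral_norm_sq (fun n => memLp_restrict_of_continuous measurableSet_ball hK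
    hsub hfin (hφ n).continuous) hu.memLp h1
  have m2 := tendsto_integral_norm_sq (fun n => memLp_restrict_of_continuous measurableSet_ball hK
    hsub hfin (continuous_gradient (hφ n))) hu.memLp_grad h2
  have m3 := tendsto_integral_norm_sq (fun n => by
    rw [arclength_ball c hR]
    exact memLp_restrict_of_continuous Metric.isClosed_sphere.measurableSet hK
      Metric.sphere_subset_closedBall (hausdorffMeasure_sphere_lt_top c hR) (hφ n).continuous)
    hgL h3
  simp only [Real.norm_eq_abs, sq_abs] at m1 m3
  refine le_of_tendsto_of_tendsto' (m1.const_mul _) (m2.add (m3.const_mul _)) fun n => ?_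
  have hcn := (hφ n).continuous
  refine (robin_inequality_ball hT hα hpos c hR (hφ n)).trans (le_of_eq ?_)
  rw [integral_arclength_ball c hR (by fun_prop)]
  have := (perimeter_ball_pos c hR).ne'
  field_simp

/-! ### Classical gradients are weak gradients -/

/-- Integration by parts needs `u` differentiable only on the support of the test function, which is
compact in Ω; behaviour of `u` at the boundary is irrelevant. -/
theorem isWeakGradient_of_contDiffOn {Ω : Set ℂ} (hΩ : IsOpen Ω) {u : ℂ → ℝ}
    (hu : ContDiffOn ℝ ∞ u Ω) : IsWeakGradient Ω u (gradient u) := by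
  intro φ hφ hφc hφΩ v
  have hdiff : ∀ x ∈ Ω, DifferentiableAt ℝ u x := fun x hx =>
    (hu.differentiableOn (by simp)).differentiableAt (hΩ.mem_nhds hx)
  have hφ0 : ∀ x ∉ tsupport φ, φ x = 0 := fun x hx => image_eq_zero_of_notMem_tsupport hx
  have hφ1 : ∀ x ∉ tsupport φ, fderiv ℝ φ x v = 0 := fun x hx => by
    rw [fderiv_of_notMem_tsupport ℝ hx]; rfl
  have hu1 : ContinuousOn u (tsupport φ) := hu.continuousOn.mono hφΩ
  have hu2 : ContinuousOn (fun x => fderiv ℝ u x v) (tsupport φ) :=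
    ((hu.continuousOn_fderiv_of_isOpen hΩ (by simp)).mono hφΩ).clm_apply continuousOn_const
  have hφd : Continuous fun x => fderiv ℝ φ x v := by
    have := hφ.continuous_fderiv (by simp)
    fun_prop
  have hint : ∀ f : ℂ → ℝ, ContinuousOn f (tsupport φ) → (∀ x ∉ tsupport φ, f x = 0) →
      Integrable f := by
    intro f hf h0
    rw [← integrableOn_iff_integrable_of_support_subset (s := tsupport φ)]
    · exact hf.integrableOn_compact hφc
    · intro x hx
      by_contra h
      exact hx (h0 x h)
  have key := integral_mul_fderiv_eq_neg_fderiv_mul_of_integrable (μ := volume) (f := u) (g := φ)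
    (v := v) (hint _ (hu2.mul hφ.continuous.continuousOn) fun x hx => by simp [hφ0 x hx])
    (hint _ (hu1.mul hφd.continuousOn) fun x hx => by simp [hφ1 x hx])
    (hint _ (hu1.mul hφ.continuous.continuousOn) fun x hx => by simp [hφ0 x hx])
    (fun x hx => hdiff x (hφΩ hx)) (fun x _ => (hφ.differentiable (by simp)) x)
  rw [setIntegral_eq_integral_of_forall_compl_eq_zero
    fun x hx => by simp [hφ1 x fun h => hx (hφΩ h)],
    setIntegral_eq_integral_of_forall_compl_eq_zero
    fun x hx => by simp [hφ0 x fun h => hx (hφΩ h)], key]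
  simp only [inner_gradient_left]

/-! ### Functions with constant boundary values -/

theorem tendsto_eLpNorm_two_zero {X E : Type*} [MeasurableSpace X] {μ : Measure X}
    [NormedAddCommGroup E] {f : ℕ → X → E} (hf : ∀ n, MemLp (f n) 2 μ)
    (h : Tendsto (fun n => ∫ x, ‖f n x‖ ^ 2 ∂μ) atTop (𝓝 0)) :
    Tendsto (fun n => eLpNorm (f n) 2 μ) atTop (𝓝 0) := by
  simp only [integral_norm_sq_eq_eLpNorm (hf _)] at h
  have h1 := h.sqrt
  simp only [Real.sqrt_sq ENNReal.toReal_nonneg, Real.sqrt_zero] at h1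
  rw [← ENNReal.toReal_zero] at h1
  exact (ENNReal.tendsto_toReal_iff (fun n => (hf n).2.ne) ENNReal.zero_ne_top).1 h1

/-- A smooth cutoff of the identity. -/
noncomputable def cutoff (s : ℝ) : ℝ := s * Real.smoothTransition (s - 1)

theorem contDiff_cutoff : ContDiff ℝ ∞ cutoff :=
  contDiff_id.mul (Real.smoothTransition.contDiff.comp (contDiff_id.sub contDiff_const))

theorem cutoff_of_le_one {s : ℝ} (hs : s ≤ 1) : cutoff s = 0 := by
  rw [cutoff, Real.smoothTransition.zero_of_nonpos (by linarith), mul_zero]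

theorem cutoff_of_two_le {s : ℝ} (hs : 2 ≤ s) : cutoff s = s := by
  rw [cutoff, Real.smoothTransition.one_of_one_le (by linarith), mul_one]

theorem deriv_cutoff_of_two_lt {s : ℝ} (hs : 2 < s) : deriv cutoff s = 1 := by
  have h : cutoff =ᶠ[𝓝 s] id := by
    filter_upwards [lt_mem_nhds hs] with x hx using cutoff_of_two_le hx.le
  rw [h.deriv_eq, deriv_id]

/-- Both differences vanish beyond 2 and are continuous on [0, 2]. -/
theorem exists_bound_cutoff : ∃ C : ℝ, ∀ s : ℝ, 0 ≤ s →
    |cutoff s - s| ≤ C ∧ |deriv cutoff s - 1| ≤ C := by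
  have hd : Continuous (deriv cutoff) := contDiff_cutoff.continuous_deriv (by simp)
  have hc : Continuous cutoff := contDiff_cutoff.continuous
  obtain ⟨C₁, h₁⟩ := (isCompact_Icc (a := (0 : ℝ)) (b := 2)).exists_bound_of_continuousOn
    (f := fun s => cutoff s - s) (by fun_prop)
  obtain ⟨C₂, h₂⟩ := (isCompact_Icc (a := (0 : ℝ)) (b := 2)).exists_bound_of_continuousOn
    (f := fun s => deriv cutoff s - 1) (by fun_prop)
  refine ⟨max C₁ C₂, fun s hs => ?_⟩
  rcases le_or_gt s 2 with h | h
  · exact ⟨(h₁ s ⟨hs, h⟩).trans (le_max_left _ _), (h₂ s ⟨hs, h⟩).trans (le_max_right _ _)⟩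
  · have : 0 ≤ C₁ := (abs_nonneg _).trans (h₁ 0 ⟨le_rfl, two_pos.le⟩)
    rw [cutoff_of_two_le h.le, deriv_cutoff_of_two_lt h]
    simp [this]

/-- A smooth function of finite energy which tends to the constant `m` at the boundary from above
has trace `m`. -/
theorem isTrace_const {Ω : Set ℂ} (hΩ : IsOpen Ω) (hΩv : volume Ω < ⊤)
    (hfin : (μH[1] : Measure ℂ) (frontier Ω) < ⊤) {u : ℂ → ℝ} {m : ℝ}
    (hu : ContDiffOn ℝ ∞ u Ω) (hgrad : MemLp (gradient u) 2 (volume.restrict Ω))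
    (hm : ∀ w ∈ Ω, m < u w)
    (hK : ∀ ε > 0, ∃ K ⊆ Ω, IsCompact K ∧ ∀ w ∈ Ω, m + ε < u w → w ∈ K) :
    IsTrace Ω u (gradient u) fun _ => m := by
  classical
  have : IsFiniteMeasure (volume.restrict Ω) := ⟨by rwa [Measure.restrict_apply_univ]⟩
  have : IsFiniteMeasure (arclength Ω) := ⟨by rwa [arclength, Measure.restrict_apply_univ]⟩
  obtain ⟨C, hC⟩ := exists_bound_cutoff
  have hdiff : ∀ x ∈ Ω, DifferentiableAt ℝ u x := fun x hx =>
    (hu.differentiableOn (by simp)).differentiableAt (hΩ.mem_nhds hx)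
  -- Equals m below m + 1/(n+1) and t above m + 2/(n+1).
  set χ : ℕ → ℝ → ℝ := fun n t => m + ((n : ℝ) + 1)⁻¹ * cutoff ((n + 1) * (t - m)) with hχ
  have hn (n : ℕ) : (0 : ℝ) < n + 1 := by positivity
  have hχs (n : ℕ) : ContDiff ℝ ∞ (χ n) :=
    contDiff_const.add (contDiff_const.mul (contDiff_cutoff.comp (by fun_prop)))
  have hχd (n : ℕ) (t : ℝ) : HasDerivAt (χ n) (deriv cutoff ((n + 1) * (t - m))) t := by
    have h1 : HasDerivAt (fun t => ((n : ℝ) + 1) * (t - m)) (n + 1) t := by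
      simpa using ((hasDerivAt_id t).sub_const m).const_mul ((n : ℝ) + 1)
    have h2 := ((contDiff_cutoff.differentiable (by simp)) ((n + 1) * (t - m))).hasDerivAt.comp t h1
    convert! (h2.const_mul ((n : ℝ) + 1)⁻¹).const_add m using 1
    have := (hn n).ne'
    field_simp
  set φ : ℕ → ℂ → ℝ := fun n w => if w ∈ Ω then χ n (u w) else m with hφ
  have hφin (n : ℕ) {w : ℂ} (hw : w ∈ Ω) : φ n =ᶠ[𝓝 w] χ n ∘ u := by
    filter_upwards [hΩ.mem_nhds hw] with x hx
    simp [hφ, hx]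
  have hφg (n : ℕ) {w : ℂ} (hw : w ∈ Ω) :
      gradient (φ n) w = deriv cutoff ((n + 1) * (u w - m)) • gradient u w := by
    have h1 := (hχd n (u w)).comp_hasFDerivAt w (hdiff w hw).hasFDerivAt
    rw [gradient, (hφin n hw).fderiv_eq, h1.fderiv, gradient, map_smul]
  have hφs (n : ℕ) : ContDiff ℝ ∞ (φ n) := by
    obtain ⟨K, hKΩ, hKc, hKm⟩ := hK (((n : ℝ) + 1)⁻¹) (by positivity)
    rw [contDiff_iff_contDiffAt]
    intro w
    by_cases hw : w ∈ Ω
    · exact ((hχs n).contDiffAt.comp w (hu.contDiffAt (hΩ.mem_nhds hw))).congr_of_eventuallyEq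
        (hφin n hw)
    -- Off the compact set containing {u > m + 1/(n+1)} the truncation is constantly m, so extension
    -- by m is smooth across the boundary.
    · refine (contDiffAt_const (c := m)).congr_of_eventuallyEq ?_
      filter_upwards [hKc.isClosed.isOpen_compl.mem_nhds fun h => hw (hKΩ h)] with x hx
      by_cases hxΩ : x ∈ Ω
      · have h1 : u x ≤ m + ((n : ℝ) + 1)⁻¹ := by
          by_contra! h
          exact hx (hKm x hxΩ h)
        have h2 : ((n : ℝ) + 1) * (u x - m) ≤ 1 := by
          rw [← le_div_iff₀' (hn n), one_div]; linarith
        simp [hφ, hxΩ, hχ, cutoff_of_le_one h2]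
      · simp [hφ, hxΩ]
  refine ⟨memLp_const m, φ, hφs, ?_, ?_, ?_⟩
  -- Uniform convergence: |φ n − u| ≤ C/(n+1) on Ω, which has finite area.
  · have hb : Tendsto (fun n : ℕ => volume.restrict Ω Set.univ ^ (2 : ENNReal).toReal⁻¹ *
        ENNReal.ofReal (((n : ℝ) + 1)⁻¹ * C)) atTop (𝓝 0) := by
      have h1 : Tendsto (fun n : ℕ => ((n : ℝ) + 1)⁻¹ * C) atTop (𝓝 0) := by
        have := (tendsto_one_div_add_atTop_nhds_zero_nat (𝕜 := ℝ)).mul_const C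
        simpa using this
      have h2 := ENNReal.Tendsto.const_mul (ENNReal.tendsto_ofReal h1)
        (a := volume.restrict Ω Set.univ ^ (2 : ENNReal).toReal⁻¹)
        (Or.inr (ENNReal.rpow_ne_top_of_nonneg (by positivity) (measure_ne_top _ _)))
      simpa using h2
    refine tendsto_of_tendsto_of_tendsto_of_le_of_le tendsto_const_nhds hb (fun _ => zero_le) ?_
    intro n
    refine eLpNorm_le_of_ae_bound ?_
    filter_upwards [ae_restrict_mem hΩ.measurableSet] with w hw
    have h1 := (hC (((n : ℝ) + 1) * (u w - m)) (mul_nonneg (hn n).le (by linarith [hm w hw]))).1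
    have h2 : φ n w - u w = ((n : ℝ) + 1)⁻¹ *
        (cutoff ((n + 1) * (u w - m)) - (n + 1) * (u w - m)) := by
      have := (hn n).ne'
      simp only [hφ, hw, if_true, hχ]
      field_simp
      ring
    rw [h2, norm_mul, Real.norm_of_nonneg (inv_nonneg.2 (hn n).le), Real.norm_eq_abs]
    gcongr
  · have hdc : Continuous (deriv cutoff) := contDiff_cutoff.continuous_deriv (by simp)
    have hbound (n : ℕ) {w : ℂ} (hw : w ∈ Ω) :
        ‖gradient (φ n) w - gradient u w‖ ≤ C * ‖gradient u w‖ := by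
      have h1 := (hC (((n : ℝ) + 1) * (u w - m)) (mul_nonneg (hn n).le (by linarith [hm w hw]))).2
      rw [hφg n hw, show deriv cutoff ((n + 1) * (u w - m)) • gradient u w - gradient u w =
        (deriv cutoff ((n + 1) * (u w - m)) - 1) • gradient u w by rw [sub_smul, one_smul],
        norm_smul, Real.norm_eq_abs]
      gcongr
    have hmeas (n : ℕ) : AEStronglyMeasurable (fun w => gradient (φ n) w - gradient u w)
        (volume.restrict Ω) :=
      (continuous_gradient (hφs n)).aestronglyMeasurable.sub hgrad.1
    refine tendsto_eLpNorm_two_zero (fun n => ?_) ?_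
    · refine MemLp.of_le_mul (c := C) hgrad (hmeas n) ?_
      filter_upwards [ae_restrict_mem hΩ.measurableSet] with w hw using hbound n hw
    -- Dominated convergence: at each point u > m, so the gradients agree exactly once n is large.
    · rw [← integral_zero ℂ ℝ (μ := volume.restrict Ω)]
      refine tendsto_integral_of_dominated_convergence (fun w => (C * ‖gradient u w‖) ^ 2)
        (fun n => (hmeas n).norm.pow 2) ?_ (fun n => ?_) ?_
      · simp only [mul_pow]
        exact (hgrad.integrable_norm_pow two_ne_zero).const_mul _
      · filter_upwards [ae_restrict_mem hΩ.measurableSet] with w hw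
        rw [Real.norm_of_nonneg (by positivity)]
        exact pow_le_pow_left₀ (norm_nonneg _) (hbound n hw) 2
      · filter_upwards [ae_restrict_mem hΩ.measurableSet] with w hw
        refine tendsto_const_nhds.congr' ?_
        have hw' : 0 < u w - m := by linarith [hm w hw]
        filter_upwards [(tendsto_natCast_atTop_atTop (R := ℝ)).eventually_gt_atTop (2 / (u w - m))]
          with n hn'
        rw [div_lt_iff₀ hw'] at hn'
        rw [hφg n hw, deriv_cutoff_of_two_lt (by linarith), one_smul, sub_self]
        simp
  -- The open set Ω misses its frontier, so φ n equals m there.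
  · have h (n : ℕ) : eLpNorm (fun x => φ n x - m) 2 (arclength Ω) = 0 := by
      have hmeas : AEStronglyMeasurable (fun x => φ n x - m) (arclength Ω) :=
        ((hφs n).continuous.sub continuous_const).aestronglyMeasurable
      rw [eLpNorm_eq_zero_iff hmeas two_ne_zero]
      filter_upwards [ae_restrict_mem (μ := μH[1]) isClosed_frontier.measurableSet] with w hw
      rw [hΩ.frontier_eq] at hw
      simp [hφ, hw.2]
    simp only [h]
    exact tendsto_const_nhds

/-! ### The transplanted radial eigenfunction -/

theorem contDiff_radial (T : ℝ) : ContDiff ℝ ∞ fun z : ℂ => bessel 0 (T * ‖z‖ ^ 2) :=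
  (contDiff_bessel 0).comp (contDiff_const.mul (contDiff_norm_sq ℝ))

theorem norm_fderiv_radial {T : ℝ} (z : ℂ) :
    ‖fderiv ℝ (fun z : ℂ => bessel 0 (T * ‖z‖ ^ 2)) z‖ =
      |2 * T * ‖z‖ * bessel 1 (T * ‖z‖ ^ 2)| := by
  have h1 : HasFDerivAt (fun z : ℂ => T * ‖z‖ ^ 2) (T • (2 • innerSL ℝ z)) z :=
    (hasStrictFDerivAt_norm_sq z).hasFDerivAt.const_mul T
  have h2 := (hasDerivAt_bessel 0 (T * ‖z‖ ^ 2)).comp_hasFDerivAt z h1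
  rw [show fderiv ℝ (fun z : ℂ => bessel 0 (T * ‖z‖ ^ 2)) z = _ from h2.fderiv,
    ← Nat.cast_smul_eq_nsmul ℝ, norm_smul, norm_smul, norm_smul, innerSL_apply_norm]
  simp [abs_mul]
  ring

theorem strictAntiOn_bessel_zero {T : ℝ} (hpos : ∀ t ∈ Set.Icc 0 T, 0 < bessel 1 t) :
    StrictAntiOn (bessel 0) (Set.Icc 0 T) := by
  refine strictAntiOn_of_deriv_neg (convex_Icc _ _) (continuous_bessel 0).continuousOn
    fun t ht => ?_
  rw [(hasDerivAt_bessel 0 t).deriv]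
  linarith [hpos t (interior_subset ht)]

/-- The function `bessel 0 (T |F⁻¹|²)` on `F '' 𝔻`. -/
noncomputable def transplant (F : ℂ → ℂ) (T : ℝ) (w : ℂ) : ℝ :=
  bessel 0 (T * ‖Function.invFunOn F (Metric.ball 0 1) w‖ ^ 2)

section Transplant

variable {F : ℂ → ℂ} {Ω : Set ℂ} {T : ℝ}

theorem IsConformalOnto.isOpen (hF : IsConformalOnto F Ω) : IsOpen Ω := by
  rw [← hF.image_eq]
  exact isOpen_image_of_injOn Metric.isOpen_ball hF.holomorphic hF.injOn

theorem transplant_apply (hF : IsConformalOnto F Ω) {z : ℂ} (hz : z ∈ Metric.ball (0 : ℂ) 1) :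
    transplant F T (F z) = bessel 0 (T * ‖z‖ ^ 2) := by
  rw [transplant, hF.injOn.leftInvOn_invFunOn hz]

theorem contDiffOn_transplant (hF : IsConformalOnto F Ω) :
    ContDiffOn ℝ ∞ (transplant F T) Ω := by
  have h := (differentiableOn_invFunOn Metric.isOpen_ball hF.holomorphic hF.injOn)
  rw [hF.image_eq] at h
  exact (contDiff_radial T).comp_contDiffOn ((h.contDiffOn hF.isOpen).restrict_scalars ℝ)

/-- Chain rule: the factor 1/|F'| from the inverse cancels the Jacobian. Equality holds, but this
direction suffices for a trial function. -/
theorem norm_gradient_transplant_le (hF : IsConformalOnto F Ω) {z : ℂ}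
    (hz : z ∈ Metric.ball (0 : ℂ) 1) :
    ‖deriv F z‖ ^ 2 * ‖gradient (transplant F T) (F z)‖ ^ 2 ≤
      (2 * T * ‖z‖ * bessel 1 (T * ‖z‖ ^ 2)) ^ 2 := by
  have hd := deriv_ne_zero_of_injOn Metric.isOpen_ball hF.holomorphic hF.injOn hz
  have h1 := ((hasDerivAt_invFunOn Metric.isOpen_ball hF.holomorphic hF.injOn hz
    hd).hasFDerivAt).restrictScalars ℝ
  have h2 : HasFDerivAt (fun z : ℂ => bessel 0 (T * ‖z‖ ^ 2))
      (fderiv ℝ (fun z : ℂ => bessel 0 (T * ‖z‖ ^ 2)) z)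
      (Function.invFunOn F (Metric.ball 0 1) (F z)) := by
    rw [hF.injOn.leftInvOn_invFunOn hz]
    exact ((contDiff_radial T).differentiable (by simp) z).hasFDerivAt
  have h3 := (h2.comp (F z) h1).fderiv
  have h4 : ‖gradient (transplant F T) (F z)‖ ≤
      |2 * T * ‖z‖ * bessel 1 (T * ‖z‖ ^ 2)| * ‖deriv F z‖⁻¹ := by
    rw [norm_gradient_eq_norm_fderiv, show fderiv ℝ (transplant F T) (F z) = _ from h3]
    refine (ContinuousLinearMap.opNorm_comp_le _ _).trans ?_
    rw [norm_fderiv_radial, ContinuousLinearMap.norm_restrictScalars,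
      ContinuousLinearMap.norm_toSpanSingleton, norm_inv]
  rw [← mul_pow, ← sq_abs (2 * T * ‖z‖ * bessel 1 (T * ‖z‖ ^ 2))]
  refine pow_le_pow_left₀ (by positivity) ?_ 2
  have := norm_pos_iff.2 hd
  calc _ ≤ ‖deriv F z‖ * (|2 * T * ‖z‖ * bessel 1 (T * ‖z‖ ^ 2)| * ‖deriv F z‖⁻¹) := by gcongr
    _ = _ := by field_simp

theorem continuousOn_deriv (hF : IsConformalOnto F Ω) :
    ContinuousOn (deriv F) (Metric.ball 0 1) :=
  (hF.holomorphic.deriv Metric.isOpen_ball).continuousOn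

theorem continuousOn_gradient_transplant (hF : IsConformalOnto F Ω) :
    ContinuousOn (gradient (transplant F T)) Ω :=
  (LinearIsometryEquiv.continuous _).comp_continuousOn
    ((contDiffOn_transplant hF).continuousOn_fderiv_of_isOpen hF.isOpen (by simp))

theorem integrableOn_deriv_sq_mul_gradient_sq (hF : IsConformalOnto F Ω) :
    IntegrableOn (fun z => ‖deriv F z‖ ^ 2 * ‖gradient (transplant F T) (F z)‖ ^ 2)
      (Metric.ball 0 1) := by
  have hb1 := continuous_bessel 1
  have hi := integrableOn_ball_of_continuous (f := fun z : ℂ =>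
    (2 * T * ‖z‖ * bessel 1 (T * ‖z‖ ^ 2)) ^ 2) (by fun_prop) 0 1
  refine Integrable.mono' hi ?_ ?_
  · refine ContinuousOn.aestronglyMeasurable ?_ measurableSet_ball
    refine ((continuousOn_deriv hF).norm.pow 2).mul (ContinuousOn.pow (ContinuousOn.norm ?_) 2)
    refine (continuousOn_gradient_transplant hF).comp hF.holomorphic.continuousOn ?_
    rw [← hF.image_eq]
    exact Set.mapsTo_image _ _
  · filter_upwards [ae_restrict_mem measurableSet_ball] with z hz
    rw [Real.norm_of_nonneg (by positivity)]
    exact norm_gradient_transplant_le hF hz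

theorem memLp_gradient_transplant (hF : IsConformalOnto F Ω) :
    MemLp (gradient (transplant F T)) 2 (volume.restrict Ω) := by
  have hm : AEStronglyMeasurable (gradient (transplant F T)) (volume.restrict Ω) :=
    (continuousOn_gradient_transplant hF).aestronglyMeasurable hF.isOpen.measurableSet
  rw [← memLp_norm_iff hm, memLp_two_iff_integrable_sq hm.norm]
  change IntegrableOn _ Ω
  rw [← hF.image_eq, integrableOn_image_of_injOn_holomorphic Metric.isOpen_ball hF.holomorphic
    hF.injOn]
  exact integrableOn_deriv_sq_mul_gradient_sq hF

theorem integral_gradient_transplant_le (hF : IsConformalOnto F Ω) :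
    ∫ w in Ω, ‖gradient (transplant F T) w‖ ^ 2 ≤
      ∫ z in Metric.ball (0 : ℂ) 1, (2 * T * ‖z‖ * bessel 1 (T * ‖z‖ ^ 2)) ^ 2 := by
  have hb1 := continuous_bessel 1
  conv_lhs => rw [← hF.image_eq]
  rw [integral_image_of_injOn_holomorphic Metric.isOpen_ball hF.holomorphic hF.injOn]
  exact setIntegral_mono_on (integrableOn_deriv_sq_mul_gradient_sq hF)
    (integrableOn_ball_of_continuous (by fun_prop) 0 1) measurableSet_ball
    fun z hz => norm_gradient_transplant_le hF hz

/-- The integral of |F'|² is the area of Ω. -/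
theorem memLp_deriv (hF : IsConformalOnto F Ω) (hΩ : volume Ω < ⊤) :
    MemLp (deriv F) 2 (volume.restrict (Metric.ball 0 1)) := by
  have hm : AEStronglyMeasurable (deriv F) (volume.restrict (Metric.ball 0 1)) :=
    (continuousOn_deriv hF).aestronglyMeasurable measurableSet_ball
  rw [← memLp_norm_iff hm, memLp_two_iff_integrable_sq hm.norm]
  have h := (integrableOn_image_of_injOn_holomorphic Metric.isOpen_ball hF.holomorphic
    hF.injOn (fun _ => (1 : ℝ))).1 (by rw [hF.image_eq]; exact integrableOn_const hΩ.ne)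
  have h' : IntegrableOn (fun z => ‖deriv F z‖ ^ 2) (Metric.ball 0 1) := by simpa using h
  exact h'

theorem mul_sq_norm_mem_Icc (hT : 0 < T) {z : ℂ} (hz : ‖z‖ ≤ 1) : T * ‖z‖ ^ 2 ∈ Set.Icc 0 T :=
  ⟨by positivity, mul_le_of_le_one_right hT.le (pow_le_one₀ (norm_nonneg z) hz)⟩

/-- The mass of the transplanted function: the disk average of `|F'|²` splits orthogonally. -/
theorem integral_transplant_sq (hF : IsConformalOnto F Ω) (hΩ : volume Ω < ⊤) :
    ∫ w in Ω, transplant F T w ^ 2 =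
      ‖deriv F 0‖ ^ 2 * (∫ z in Metric.ball (0 : ℂ) 1, bessel 0 (T * ‖z‖ ^ 2) ^ 2) +
        ∫ z in Metric.ball (0 : ℂ) 1, bessel 0 (T * ‖z‖ ^ 2) ^ 2 * ‖deriv F z - deriv F 0‖ ^ 2 := by
  have hb0 := continuous_bessel 0
  have hFc := continuousOn_deriv hF
  have hL := memLp_deriv hF hΩ
  have hfinB : IsFiniteMeasure (volume.restrict (Metric.ball (0 : ℂ) 1)) :=
    ⟨by rw [Measure.restrict_apply_univ]; exact measure_ball_lt_top⟩
  have hL' : MemLp (fun z => deriv F z - deriv F 0) 2 (volume.restrict (Metric.ball 0 1)) :=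
    hL.sub (memLp_const _)
  obtain ⟨M, hM⟩ := (isCompact_closedBall (0 : ℂ) 1).exists_bound_of_continuousOn
    (f := fun z : ℂ => bessel 0 (T * ‖z‖ ^ 2) ^ 2) (by fun_prop)
  have hbd : ∀ᵐ z ∂volume.restrict (Metric.ball (0 : ℂ) 1), ‖bessel 0 (T * ‖z‖ ^ 2) ^ 2‖ ≤ M := by
    filter_upwards [ae_restrict_mem measurableSet_ball] with z hz
      using hM z (Metric.ball_subset_closedBall hz)
  have hwm : AEStronglyMeasurable (fun z : ℂ => bessel 0 (T * ‖z‖ ^ 2) ^ 2)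
      (volume.restrict (Metric.ball (0 : ℂ) 1)) :=
    Continuous.aestronglyMeasurable (by fun_prop)
  -- Polarization: |F'|² = |F'(0)|² + 2 Re g + |F' − F'(0)|², with g holomorphic and zero at the
  -- origin.
  set g : ℂ → ℂ := fun z => (starRingEnd ℂ) (deriv F 0) * (deriv F z - deriv F 0) with hg
  have hgi : Integrable g (volume.restrict (Metric.ball (0 : ℂ) 1)) :=
    (hL'.integrable one_le_two).const_mul _
  have hwgi : IntegrableOn (fun z => bessel 0 (T * ‖z‖ ^ 2) ^ 2 • g z) (Metric.ball 0 1) :=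
    hgi.bdd_smul M hwm hbd
  have hzero : ∫ z in Metric.ball (0 : ℂ) 1, bessel 0 (T * ‖z‖ ^ 2) ^ 2 • g z = 0 := by
    refine integral_ball_radial_mul_holomorphic (w := fun r => bessel 0 (T * r ^ 2) ^ 2)
      (by fun_prop) ?_ hwgi (by simp [hg])
    exact ((hF.holomorphic.deriv Metric.isOpen_ball).sub_const _).const_mul _
  have hre : ∫ z in Metric.ball (0 : ℂ) 1, bessel 0 (T * ‖z‖ ^ 2) ^ 2 * (g z).re = 0 := by
    have h := integral_re hwgi
    simpa only [hzero, RCLike.re_to_complex, Complex.smul_re, smul_eq_mul, Complex.zero_re] using h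
  have hi1 : IntegrableOn (fun z : ℂ => ‖deriv F 0‖ ^ 2 * bessel 0 (T * ‖z‖ ^ 2) ^ 2)
      (Metric.ball 0 1) := integrableOn_ball_of_continuous (by fun_prop) 0 1
  have hi2 : IntegrableOn (fun z : ℂ => 2 * (bessel 0 (T * ‖z‖ ^ 2) ^ 2 * (g z).re))
      (Metric.ball 0 1) := by
    have := hwgi.re.const_mul 2
    simpa only [IntegrableOn, RCLike.re_to_complex, Complex.smul_re, smul_eq_mul] using this
  have hi3 : IntegrableOn (fun z : ℂ => bessel 0 (T * ‖z‖ ^ 2) ^ 2 *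
      ‖deriv F z - deriv F 0‖ ^ 2) (Metric.ball 0 1) :=
    (hL'.integrable_norm_pow two_ne_zero).bdd_smul M hwm hbd
  have hexp : ∀ z ∈ Metric.ball (0 : ℂ) 1, ‖deriv F z‖ ^ 2 • transplant F T (F z) ^ 2 =
      (‖deriv F 0‖ ^ 2 * bessel 0 (T * ‖z‖ ^ 2) ^ 2 +
        2 * (bessel 0 (T * ‖z‖ ^ 2) ^ 2 * (g z).re)) +
        bessel 0 (T * ‖z‖ ^ 2) ^ 2 * ‖deriv F z - deriv F 0‖ ^ 2 := by
    intro z hz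
    rw [transplant_apply hF hz]
    simp only [hg, smul_eq_mul, ← Complex.normSq_eq_norm_sq, Complex.normSq_apply, Complex.mul_re,
      Complex.conj_re, Complex.conj_im, Complex.sub_re, Complex.sub_im]
    ring
  have hadd := integral_add (hi1.add hi2) hi3
  simp only [Pi.add_apply] at hadd
  conv_lhs => rw [← hF.image_eq]
  rw [integral_image_of_injOn_holomorphic Metric.isOpen_ball hF.holomorphic hF.injOn,
    setIntegral_congr_fun measurableSet_ball hexp, hadd, integral_add hi1 hi2, integral_const_mul, integral_const_mul, hre, mul_zero, add_zero]

theorem memH1_transplant (hT : 0 < T) (hF : IsConformalOnto F Ω) (hΩ : volume Ω < ⊤) :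
    MemH1 Ω (transplant F T) (gradient (transplant F T)) := by
  have : IsFiniteMeasure (volume.restrict Ω) := ⟨by rwa [Measure.restrict_apply_univ]⟩
  refine ⟨?_, memLp_gradient_transplant hF,
    isWeakGradient_of_contDiffOn hF.isOpen (contDiffOn_transplant hF)⟩
  obtain ⟨M, hM⟩ := (isCompact_Icc (a := 0) (b := T)).exists_bound_of_continuousOn
    (continuous_bessel 0).continuousOn
  refine MemLp.of_bound ((contDiffOn_transplant hF).continuousOn.aestronglyMeasurable
    hF.isOpen.measurableSet) M ?_
  filter_upwards [ae_restrict_mem hF.isOpen.measurableSet] with w hw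
  rw [← hF.image_eq] at hw
  obtain ⟨z, hz, rfl⟩ := hw
  rw [transplant_apply hF hz]
  exact hM _ (mul_sq_norm_mem_Icc hT (mem_ball_zero_iff.1 hz).le)

/-- The profile decreases strictly to `bessel 0 T` as |z| → 1, so each higher superlevel set is the
F-image of a compact subset of the open disk. -/
theorem isTrace_transplant (hT : 0 < T) (hpos : ∀ t ∈ Set.Icc 0 T, 0 < bessel 1 t)
    (hF : IsConformalOnto F Ω) (hΩ : volume Ω < ⊤)
    (hfin : (μH[1] : Measure ℂ) (frontier Ω) < ⊤) :
    IsTrace Ω (transplant F T) (gradient (transplant F T)) fun _ => bessel 0 T := by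
  have hb0 := continuous_bessel 0
  refine isTrace_const hF.isOpen hΩ hfin (contDiffOn_transplant hF) (memLp_gradient_transplant hF)
    ?_ ?_
  · intro w hw
    rw [← hF.image_eq] at hw
    obtain ⟨z, hz, rfl⟩ := hw
    rw [transplant_apply hF hz]
    rw [mem_ball_zero_iff] at hz
    refine strictAntiOn_bessel_zero hpos (mul_sq_norm_mem_Icc hT hz.le) ⟨hT.le, le_rfl⟩ ?_
    exact mul_lt_of_lt_one_right hT (pow_lt_one₀ (norm_nonneg z) hz two_ne_zero)
  · intro ε hε
    set K : Set ℂ := Metric.closedBall 0 1 ∩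
      (fun z : ℂ => bessel 0 (T * ‖z‖ ^ 2)) ⁻¹' Set.Ici (bessel 0 T + ε)
    have hKc : IsCompact K :=
      (isCompact_closedBall _ _).inter_right (isClosed_Ici.preimage (by fun_prop))
    have hKB : K ⊆ Metric.ball 0 1 := by
      rintro z ⟨hz, hz'⟩
      rw [mem_closedBall_zero_iff] at hz
      rw [mem_ball_zero_iff]
      refine lt_of_le_of_ne hz fun h => ?_
      simp only [Set.mem_preimage, h, one_pow, mul_one, Set.mem_Ici] at hz'
      linarith
    refine ⟨F '' K, ?_, hKc.image_of_continuousOn (hF.holomorphic.continuousOn.mono hKB), ?_⟩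
    · rw [← hF.image_eq]
      exact Set.image_mono hKB
    · intro w hw hlt
      rw [← hF.image_eq] at hw
      obtain ⟨z, hz, rfl⟩ := hw
      rw [transplant_apply hF hz] at hlt
      exact Set.mem_image_of_mem F ⟨Metric.ball_subset_closedBall hz, hlt.le⟩

end Transplant

/-! ### The trial-function bound on the first eigenvalue -/

/-- The squared norm of the radial eigenfunction on the unit disk. -/
noncomputable def radialMass (T : ℝ) : ℝ :=
  ∫ z in Metric.ball (0 : ℂ) 1, bessel 0 (T * ‖z‖ ^ 2) ^ 2

/-- The defect of linearity of `F`, weighted with the radial eigenfunction. -/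
noncomputable def nonlinearity (T : ℝ) (F : ℂ → ℂ) : ℝ :=
  ∫ z in Metric.ball (0 : ℂ) 1, bessel 0 (T * ‖z‖ ^ 2) ^ 2 * ‖deriv F z - deriv F 0‖ ^ 2

theorem nonlinearity_nonneg (T : ℝ) (F : ℂ → ℂ) : 0 ≤ nonlinearity T F :=
  integral_nonneg fun z => by positivity

theorem radialMass_pos {T : ℝ} (hT : 0 < T) (hpos : ∀ t ∈ Set.Icc 0 T, 0 < bessel 0 t) :
    0 < radialMass T := by
  have hb0 := continuous_bessel 0
  rw [radialMass, setIntegral_pos_iff_support_of_nonneg_ae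
    (Eventually.of_forall fun z => sq_nonneg _)
    (integrableOn_ball_of_continuous (by fun_prop) 0 1)]
  have h : Metric.ball (0 : ℂ) 1 ⊆
      (Function.support fun z : ℂ => bessel 0 (T * ‖z‖ ^ 2) ^ 2) ∩ Metric.ball 0 1 :=
    fun z hz => ⟨pow_ne_zero 2 (hpos _ (mul_sq_norm_mem_Icc hT (mem_ball_zero_iff.1 hz).le)).ne', hz⟩
  exact (Metric.measure_ball_pos volume 0 one_pos).trans_le (measure_mono h)

/-- The weight is positive, and F' ≠ F'(0) is an open condition; a single such point would make the
integral positive. -/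
theorem deriv_eq_of_nonlinearity_eq_zero {T : ℝ} (hT : 0 < T)
    (hpos : ∀ t ∈ Set.Icc 0 T, 0 < bessel 0 t) {F : ℂ → ℂ} {Ω : Set ℂ}
    (hF : IsConformalOnto F Ω) (hΩ : volume Ω < ⊤) (h0 : nonlinearity T F = 0) :
    ∀ z ∈ Metric.ball (0 : ℂ) 1, deriv F z = deriv F 0 := by
  have hb0 := continuous_bessel 0
  by_contra! hne
  obtain ⟨z₀, hz₀, hne⟩ := hne
  have hFc := continuousOn_deriv hF
  have hfinB : IsFiniteMeasure (volume.restrict (Metric.ball (0 : ℂ) 1)) :=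
    ⟨by rw [Measure.restrict_apply_univ]; exact measure_ball_lt_top⟩
  obtain ⟨M, hM⟩ := (isCompact_closedBall (0 : ℂ) 1).exists_bound_of_continuousOn
    (f := fun z : ℂ => bessel 0 (T * ‖z‖ ^ 2) ^ 2) (by fun_prop)
  have hw : Continuous fun z : ℂ => bessel 0 (T * ‖z‖ ^ 2) ^ 2 := by fun_prop
  have hi : IntegrableOn (fun z : ℂ => bessel 0 (T * ‖z‖ ^ 2) ^ 2 *
      ‖deriv F z - deriv F 0‖ ^ 2) (Metric.ball 0 1) := by
    refine (((memLp_deriv hF hΩ).sub (memLp_const _)).integrable_norm_pow two_ne_zero).bdd_smul M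
      hw.aestronglyMeasurable ?_
    filter_upwards [ae_restrict_mem measurableSet_ball] with z hz
      using hM z (Metric.ball_subset_closedBall hz)
  have hp : 0 < nonlinearity T F := by
    rw [nonlinearity, setIntegral_pos_iff_support_of_nonneg_ae
      (Eventually.of_forall fun z => by positivity) hi]
    set V : Set ℂ := Metric.ball 0 1 ∩ deriv F ⁻¹' {deriv F 0}ᶜ
    have hV : IsOpen V := hFc.isOpen_inter_preimage Metric.isOpen_ball isOpen_compl_singleton
    refine (hV.measure_pos volume ⟨z₀, hz₀, hne⟩).trans_le (measure_mono ?_)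
    rintro z ⟨hz, hz'⟩
    refine ⟨mul_ne_zero (pow_ne_zero 2
      (hpos _ (mul_sq_norm_mem_Icc hT (mem_ball_zero_iff.1 hz).le)).ne') ?_, hz⟩
    exact pow_ne_zero 2 (norm_ne_zero_iff.2 (sub_ne_zero.2 hz'))
  exact hp.ne' h0

theorem rayleigh_nonneg (Ω : Set ℂ) {β : ℝ} (hβ : 0 ≤ β) (u : ℂ → ℝ) (G : ℂ → ℂ) (g : ℂ → ℝ) :
    0 ≤ rayleigh Ω β u G g := by
  unfold rayleigh
  have h1 : 0 ≤ ∫ x in Ω, ‖G x‖ ^ 2 := integral_nonneg fun x => by positivity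
  have h2 : 0 ≤ ∫ x, g x ^ 2 ∂arclength Ω := integral_nonneg fun x => by positivity
  have h3 : 0 ≤ ∫ x in Ω, u x ^ 2 := integral_nonneg fun x => by positivity
  positivity

/-- The trial function on a conformal image of the disk. -/
theorem exists_trial {T α : ℝ} (hT : 0 < T) (hα0 : 0 < α)
    (hα : α / (2 * Real.pi) * bessel 0 T = 2 * T * bessel 1 T)
    (hpos : ∀ t ∈ Set.Icc 0 T, 0 < bessel 0 t) (hpos1 : ∀ t ∈ Set.Icc 0 T, 0 < bessel 1 t)
    {F : ℂ → ℂ} {Ω : Set ℂ} (hF : IsConformalOnto F Ω) (hΩ : volume Ω < ⊤)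
    (hfin : (μH[1] : Measure ℂ) (frontier Ω) < ⊤) :
    ∃ (u : ℂ → ℝ) (G : ℂ → ℂ) (g : ℂ → ℝ), MemH1 Ω u G ∧ IsTrace Ω u G g ∧
      0 < (∫ x in Ω, u x ^ 2) ∧ rayleigh Ω (α / perimeter Ω) u G g ≤
        4 * T * radialMass T / (‖deriv F 0‖ ^ 2 * radialMass T + nonlinearity T F) := by
  have hmass := integral_transplant_sq (T := T) hF hΩ
  have hd := deriv_ne_zero_of_injOn Metric.isOpen_ball hF.holomorphic hF.injOn
    (Metric.mem_ball_self one_pos)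
  have hden : 0 < ‖deriv F 0‖ ^ 2 * radialMass T + nonlinearity T F :=
    add_pos_of_pos_of_nonneg (mul_pos (pow_pos (norm_pos_iff.2 hd) 2) (radialMass_pos hT hpos))
      (nonlinearity_nonneg T F)
  rw [← radialMass, ← nonlinearity] at hmass
  refine ⟨_, _, _, memH1_transplant hT hF hΩ, isTrace_transplant hT hpos1 hF hΩ hfin,
    by rwa [hmass], ?_⟩
  rw [rayleigh, hmass, radialMass, ← robin_energy_radial hα]
  refine div_le_div_of_nonneg_right (add_le_add (integral_gradient_transplant_le hF) ?_) hden.le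
  have hL : (arclength Ω).real Set.univ = perimeter Ω := by
    rw [arclength, measureReal_restrict_apply_univ]; rfl
  rw [integral_const, hL, smul_eq_mul]
  -- If the perimeter is 0 then α/0 = 0 and the boundary term vanishes; otherwise the length
  -- cancels.
  rcases eq_or_ne (perimeter Ω) 0 with h | h
  · rw [h]; simp; positivity
  · exact le_of_eq (by field_simp)

theorem firstEigenvalue_le {T α : ℝ} (hT : 0 < T) (hα0 : 0 < α)
    (hα : α / (2 * Real.pi) * bessel 0 T = 2 * T * bessel 1 T)
    (hpos : ∀ t ∈ Set.Icc 0 T, 0 < bessel 0 t) (hpos1 : ∀ t ∈ Set.Icc 0 T, 0 < bessel 1 t)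
    {F : ℂ → ℂ} {Ω : Set ℂ} (hF : IsConformalOnto F Ω) (hΩ : volume Ω < ⊤)
    (hfin : (μH[1] : Measure ℂ) (frontier Ω) < ⊤) :
    firstEigenvalue Ω (α / perimeter Ω) ≤
      4 * T * radialMass T / (‖deriv F 0‖ ^ 2 * radialMass T + nonlinearity T F) := by
  obtain ⟨u, G, g, h1, h2, h3, h4⟩ := exists_trial hT hα0 hα hpos hpos1 hF hΩ hfin
  rw [firstEigenvalue]
  -- For α > 0 the Rayleigh quotients are bounded below by 0.
  refine le_trans (csInf_le ⟨0, ?_⟩ ⟨u, G, g, h1, h2, h3, rfl⟩) h4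
  rintro _ ⟨u, G, g, -, -, -, rfl⟩
  exact rayleigh_nonneg Ω (div_nonneg hα0.le ENNReal.toReal_nonneg) u G g

/-! ### Lipschitz boundaries -/

/-- The frontier is compact, and near each point it is contained in a Lipschitz image of a bounded
interval. -/
theorem HasLipschitzBoundary.hausdorffMeasure_frontier_lt_top {Ω : Set ℂ}
    (h : HasLipschitzBoundary Ω) (hΩ : IsOpen Ω) (hb : Bornology.IsBounded Ω) :
    (μH[1] : Measure ℂ) (frontier Ω) < ⊤ := by
  have hc : IsCompact (frontier Ω) :=
    Metric.isCompact_of_isClosed_isBounded isClosed_frontier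
      (hb.closure.subset frontier_subset_closure)
  refine hc.measure_lt_top_of_nhdsWithin fun p hp => ?_
  obtain ⟨c, b, K, r, hcn, hbl, hr, hgraph⟩ := h p hp
  have hc0 : c ≠ 0 := norm_pos_iff.1 (by rw [hcn]; exact one_pos)
  have hbc := hbl.continuous
  set ψ : ℝ → ℂ := fun t => c⁻¹ * (t + b t * Complex.I) with hψ
  have hψl : LipschitzWith (1 + K) ψ := by
    refine LipschitzWith.of_dist_le_mul fun x y => ?_
    have h1 : ψ x - ψ y = c⁻¹ * (((x - y : ℝ) : ℂ) + ((b x - b y : ℝ) : ℂ) * Complex.I) := by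
      simp only [hψ]
      push_cast
      ring
    have h2 := hbl.dist_le_mul x y
    rw [dist_eq_norm, h1, norm_mul, norm_inv, hcn, inv_one, one_mul]
    refine (norm_add_le _ _).trans ?_
    rw [norm_mul, Complex.norm_I, mul_one, Complex.norm_real, Complex.norm_real]
    simp only [Real.dist_eq, Real.norm_eq_abs] at h2 ⊢
    push_cast
    linarith
  have hsub : frontier Ω ∩ Metric.ball p r ⊆
      ψ '' Set.Icc ((c * p).re - r) ((c * p).re + r) := by
    rintro z ⟨hz, hzb⟩
    have hzΩ : z ∉ Ω := by
      rw [hΩ.frontier_eq] at hz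
      exact hz.2
    have h1 : (c * z).im ≤ b (c * z).re := by
      by_contra! hlt
      exact hzΩ ((hgraph z hzb).2 hlt)
    -- A point strictly below the graph has a neighbourhood missing Ω, so it cannot lie on the
    -- frontier.
    have h2 : b (c * z).re ≤ (c * z).im := by
      by_contra! hlt
      have hopen : IsOpen {w : ℂ | (c * w).im < b (c * w).re} :=
        isOpen_lt (by fun_prop) (by fun_prop)
      obtain ⟨w, ⟨hw1, hw2⟩, hwΩ⟩ := mem_closure_iff.1 (frontier_subset_closure hz)
        ({w : ℂ | (c * w).im < b (c * w).re} ∩ Metric.ball p r) (hopen.inter Metric.isOpen_ball)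
        ⟨hlt, hzb⟩
      have h3 : (c * w).im < b (c * w).re := hw1
      linarith [(hgraph w hw2).1 hwΩ]
    have h3 : |(c * z).re - (c * p).re| ≤ r := by
      rw [← Complex.sub_re, ← mul_sub]
      refine (Complex.abs_re_le_norm _).trans ?_
      rw [norm_mul, hcn, one_mul]
      exact (mem_ball_iff_norm.1 hzb).le
    rw [abs_le] at h3
    refine ⟨(c * z).re, ⟨by linarith, by linarith⟩, ?_⟩
    simp only [hψ]
    rw [le_antisymm h2 h1, Complex.re_add_im, inv_mul_cancel_left₀ hc0]
  refine ⟨frontier Ω ∩ Metric.ball p r,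
    inter_mem_nhdsWithin _ (Metric.ball_mem_nhds p hr), ?_⟩
  refine lt_of_le_of_lt (measure_mono hsub)
    (lt_of_le_of_lt (hψl.hausdorffMeasure_image_le zero_le_one _) ?_)
  rw [hausdorffMeasure_real, Real.volume_Icc]
  exact ENNReal.mul_lt_top (by simp) ENNReal.ofReal_lt_top

/-- A globally Lipschitz function which parametrizes the lower unit semicircle near its bottom. -/
noncomputable def lowerArc (x : ℝ) : ℝ := -√(1 - min |x| (1 / 2) ^ 2)

/-- Clamping at 1/2 keeps both roots at least 1/2, so the slope (a+b)/(√(1−a²)+√(1−b²)) is at most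
1. -/
theorem lipschitzWith_lowerArc : LipschitzWith 1 lowerArc := by
  refine LipschitzWith.of_dist_le_mul fun x y => ?_
  rw [NNReal.coe_one, one_mul, Real.dist_eq, Real.dist_eq]
  unfold lowerArc
  set a := min |x| (1 / 2)
  set b := min |y| (1 / 2)
  have ha0 : 0 ≤ a := le_min (abs_nonneg x) (by norm_num)
  have hb0 : 0 ≤ b := le_min (abs_nonneg y) (by norm_num)
  have ha1 : a ≤ 1 / 2 := min_le_right _ _
  have hb1 : b ≤ 1 / 2 := min_le_right _ _
  have hab : |a - b| ≤ |x - y| := by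
    refine (abs_min_sub_min_le_max _ _ _ _).trans ?_
    rw [sub_self, abs_zero, max_eq_left (abs_nonneg _)]
    exact abs_abs_sub_abs_le x y
  have hA : 0 ≤ 1 - a ^ 2 := by nlinarith
  have hB : 0 ≤ 1 - b ^ 2 := by nlinarith
  have hsA : 1 / 2 ≤ √(1 - a ^ 2) := Real.le_sqrt_of_sq_le (by nlinarith)
  have hsB : 1 / 2 ≤ √(1 - b ^ 2) := Real.le_sqrt_of_sq_le (by nlinarith)
  have hprod : (-√(1 - a ^ 2) - -√(1 - b ^ 2)) * (√(1 - a ^ 2) + √(1 - b ^ 2)) =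
      (a - b) * (a + b) := by
    have h1 := Real.mul_self_sqrt hA
    have h2 := Real.mul_self_sqrt hB
    linear_combination h2 - h1
  have habs := congrArg abs hprod
  rw [abs_mul, abs_mul, abs_of_nonneg (by linarith : 0 ≤ √(1 - a ^ 2) + √(1 - b ^ 2)),
    abs_of_nonneg (by linarith : 0 ≤ a + b)] at habs
  have h3 : |(-√(1 - a ^ 2) - -√(1 - b ^ 2))| ≤ |a - b| := by
    nlinarith [abs_nonneg (-√(1 - a ^ 2) - -√(1 - b ^ 2)), abs_nonneg (a - b)]
  exact h3.trans hab

theorem hasLipschitzBoundary_disk : HasLipschitzBoundary (Metric.ball 0 1) := by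
  intro p hp
  rw [frontier_ball_eq 0 one_pos, mem_sphere_zero_iff_norm] at hp
  have hp0 : p ≠ 0 := norm_pos_iff.1 (by rw [hp]; exact one_pos)
  have hcn : ‖-Complex.I / p‖ = 1 := by simp [hp]
  -- The rotation takes p to −i; within distance 1/2 of −i the imaginary part is negative and the
  -- clamp is inactive.
  refine ⟨-Complex.I / p, lowerArc, 1, 1 / 2, hcn, lipschitzWith_lowerArc, by norm_num, ?_⟩
  intro z hz
  set w := -Complex.I / p * z with hw
  have hwn : ‖w‖ = ‖z‖ := by rw [hw, norm_mul, hcn, one_mul]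
  have hwI : ‖w + Complex.I‖ < 1 / 2 := by
    have : w + Complex.I = -Complex.I / p * (z - p) := by rw [hw]; field_simp; ring
    rw [this, norm_mul, hcn, one_mul]
    exact mem_ball_iff_norm.1 hz
  have hre : |w.re| < 1 / 2 := by
    have := (Complex.abs_re_le_norm (w + Complex.I)).trans_lt hwI
    simpa using this
  have him : w.im < 0 := by
    have := (abs_lt.1 ((Complex.abs_im_le_norm (w + Complex.I)).trans_lt hwI)).2
    simp only [Complex.add_im, Complex.I_im] at this
    linarith
  have hB : lowerArc w.re = -√(1 - w.re ^ 2) := by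
    rw [lowerArc, min_eq_left hre.le, sq_abs]
  rw [mem_ball_zero_iff, ← hwn, hB, neg_lt, Real.lt_sqrt (by linarith), ← sq_lt_one_iff₀
    (norm_nonneg w), ← Complex.normSq_eq_norm_sq, Complex.normSq_apply]
  constructor <;> intro h <;> nlinarith

theorem isJordanLipschitzDomain_disk : IsJordanLipschitzDomain (Metric.ball 0 1) where
  isOpen := Metric.isOpen_ball
  isBounded := Metric.isBounded_ball
  simplyConnected := by
    have := (convex_ball (0 : ℂ) 1).contractibleSpace ⟨0, Metric.mem_ball_self one_pos⟩
    infer_instance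
  jordan := by
    refine ⟨fun z => z, continuous_subtype_val, Circle.coe_injective, ?_⟩
    rw [frontier_ball_eq 0 one_pos]
    ext z
    constructor
    · rintro ⟨w, rfl⟩
      exact mem_sphere_zero_iff_norm.2 w.norm_coe
    · intro hz
      exact ⟨⟨z, hz⟩, rfl⟩
  lipschitz := hasLipschitzBoundary_disk

theorem isConformalOnto_affine {a : ℂ} (b : ℂ) (ha : a ≠ 0) :
    IsConformalOnto (fun z => a * z + b) (Metric.ball b ‖a‖) where
  holomorphic := by fun_prop
  injOn := affine_injOn b ha _
  image_eq := affine_image_ball a b ha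

/-! ### Eigenvalues of disks and linear maps -/

/-- The first Robin eigenvalue of a disk, with the perimeter-normalized Robin parameter. -/
theorem firstEigenvalue_ball {T α : ℝ} (hT : 0 < T) (hα0 : 0 < α)
    (hα : α / (2 * Real.pi) * bessel 0 T = 2 * T * bessel 1 T)
    (hpos : ∀ t ∈ Set.Icc 0 T, 0 < bessel 0 t) (hpos1 : ∀ t ∈ Set.Icc 0 T, 0 < bessel 1 t)
    (c : ℂ) {R : ℝ} (hR : 0 < R) :
    firstEigenvalue (Metric.ball c R) (α / perimeter (Metric.ball c R)) = 4 * T / R ^ 2 := by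
  have hF := isConformalOnto_affine (a := R) c (by exact_mod_cast hR.ne')
  rw [Complex.norm_real, Real.norm_of_nonneg hR.le] at hF
  have hfin : (μH[1] : Measure ℂ) (frontier (Metric.ball c R)) < ⊤ := by
    rw [frontier_ball_eq c hR]
    exact hausdorffMeasure_sphere_lt_top c hR
  apply le_antisymm
  · have h := firstEigenvalue_le hT hα0 hα hpos hpos1 hF measure_ball_lt_top hfin
    have hA := (radialMass_pos hT hpos).ne'
    refine h.trans (le_of_eq ?_)
    simp only [nonlinearity, deriv_affine, sub_self, norm_zero, Complex.norm_real,
      Real.norm_of_nonneg hR.le]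
    simp
    field_simp
  · refine le_csInf ?_ ?_
    -- A lower bound for the infimum needs a nonempty set of quotients; the trial function supplies
    -- one.
    · obtain ⟨u, G, g, h1, h2, h3, -⟩ :=
        exists_trial hT hα0 hα hpos hpos1 hF measure_ball_lt_top hfin
      exact ⟨_, u, G, g, h1, h2, h3, rfl⟩
    · rintro _ ⟨u, G, g, h1, h2, h3, rfl⟩
      rw [rayleigh, le_div_iff₀ h3]
      exact robin_inequality_of_isTrace hT hα hpos c hR h1 h2

theorem isLinearOnDisk_of_deriv_eq {F : ℂ → ℂ} (hF : DifferentiableOn ℂ F (Metric.ball 0 1))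
    (h : ∀ z ∈ Metric.ball (0 : ℂ) 1, deriv F z = deriv F 0) : IsLinearOnDisk F := by
  refine ⟨deriv F 0, F 0, fun z hz => ?_⟩
  have h1 : ∀ w ∈ Metric.ball (0 : ℂ) 1,
      HasDerivAt (fun w => F w - deriv F 0 * w) 0 w := fun w hw => by
    have h2 := (hF.differentiableAt (Metric.isOpen_ball.mem_nhds hw)).hasDerivAt
    rw [h w hw] at h2
    have h3 := h2.sub ((hasDerivAt_id w).const_mul (deriv F 0))
    rw [mul_one, sub_self] at h3
    exact h3
  have h2 := Metric.isOpen_ball.is_const_of_deriv_eq_zero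
    (convex_ball (0 : ℂ) 1).isPreconnected
    (fun w hw => (h1 w hw).differentiableAt.differentiableWithinAt) (fun w hw => (h1 w hw).deriv)
    hz (Metric.mem_ball_self one_pos)
  simp only [mul_zero, sub_zero] at h2
  linear_combination h2

/-- Linearity of F alone determines Ω, so the disk clause in the equality case is automatic. -/
theorem IsConformalOnto.eq_ball_of_linear {F : ℂ → ℂ} {Ω : Set ℂ} (hF : IsConformalOnto F Ω)
    {a b : ℂ} (h : ∀ z ∈ Metric.ball (0 : ℂ) 1, F z = a * z + b) :
    deriv F 0 = a ∧ a ≠ 0 ∧ Ω = Metric.ball b ‖a‖ := by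
  have h0 : (0 : ℂ) ∈ Metric.ball (0 : ℂ) 1 := Metric.mem_ball_self one_pos
  have hd : deriv F 0 = a := by
    have : F =ᶠ[𝓝 0] fun z => a * z + b := by
      filter_upwards [Metric.isOpen_ball.mem_nhds h0] with z hz using h z hz
    rw [this.deriv_eq, deriv_affine]
  have ha : a ≠ 0 := by
    rw [← hd]
    exact deriv_ne_zero_of_injOn Metric.isOpen_ball hF.holomorphic hF.injOn h0
  refine ⟨hd, ha, ?_⟩
  rw [← hF.image_eq, ← affine_image_ball a b ha]
  exact Set.image_congr h

end Robin

theorem theoremE (α : ℝ) (hα : 0 < α) (F : ℂ → ℂ) (Ω : Set ℂ)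
    (hΩ : Robin.IsJordanLipschitzDomain Ω) (hF : Robin.IsConformalOnto F Ω) :
    ((∀ (F' : ℂ → ℂ) (Ω' : Set ℂ), Robin.IsJordanLipschitzDomain Ω' →
        Robin.IsConformalOnto F' Ω' →
        Robin.scaledEigenvalue α F' Ω' ≤ Robin.scaledEigenvalue α F Ω) ↔
      (Robin.IsLinearOnDisk F ∧ Robin.IsDisk Ω)) ∧
    Robin.scaledEigenvalue α F Ω ≤
      Robin.firstEigenvalue (Metric.ball 0 1) (α / Robin.perimeter (Metric.ball 0 1)) ∧
    (Robin.scaledEigenvalue α F Ω =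
        Robin.firstEigenvalue (Metric.ball 0 1) (α / Robin.perimeter (Metric.ball 0 1)) ↔
      (Robin.IsLinearOnDisk F ∧ Robin.IsDisk Ω)) := by

  obtain ⟨T, hT, hα', hpos, hpos1⟩ := Robin.exists_robin_root
    (β := α / (2 * Real.pi)) (div_pos hα (by positivity))
  have hdisk : Robin.firstEigenvalue (Metric.ball 0 1)
      (α / Robin.perimeter (Metric.ball 0 1)) = 4 * T := by
    rw [Robin.firstEigenvalue_ball hT hα hα' hpos hpos1 0 one_pos]
    simp
  have hA := Robin.radialMass_pos hT hpos
  have hbound : ∀ (F' : ℂ → ℂ) (Ω' : Set ℂ), Robin.IsJordanLipschitzDomain Ω' →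
      Robin.IsConformalOnto F' Ω' → Robin.scaledEigenvalue α F' Ω' ≤
        4 * T * Robin.radialMass T * ‖deriv F' 0‖ ^ 2 /
          (‖deriv F' 0‖ ^ 2 * Robin.radialMass T + Robin.nonlinearity T F') := by
    intro F' Ω' hΩ' hF'
    have h := Robin.firstEigenvalue_le hT hα hα' hpos hpos1 hF' hΩ'.isBounded.measure_lt_top
      (hΩ'.lipschitz.hausdorffMeasure_frontier_lt_top hΩ'.isOpen hΩ'.isBounded)
    rw [Robin.scaledEigenvalue, mul_div_right_comm]
    exact mul_le_mul_of_nonneg_right h (sq_nonneg _)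
  have hder : ∀ (F' : ℂ → ℂ) (Ω' : Set ℂ), Robin.IsConformalOnto F' Ω' →
      0 < ‖deriv F' 0‖ ^ 2 * Robin.radialMass T := fun F' Ω' hF' =>
    mul_pos (pow_pos (norm_pos_iff.2 (Robin.deriv_ne_zero_of_injOn Metric.isOpen_ball
      hF'.holomorphic hF'.injOn (Metric.mem_ball_self one_pos))) 2) hA
  have hle : ∀ (F' : ℂ → ℂ) (Ω' : Set ℂ), Robin.IsJordanLipschitzDomain Ω' →
      Robin.IsConformalOnto F' Ω' → Robin.scaledEigenvalue α F' Ω' ≤ 4 * T := by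
    intro F' Ω' hΩ' hF'
    have hB := Robin.nonlinearity_nonneg T F'
    have hd := hder F' Ω' hF'
    refine (hbound F' Ω' hΩ' hF').trans ?_
    rw [div_le_iff₀ (by positivity)]
    nlinarith
  have heq : Robin.scaledEigenvalue α F Ω = 4 * T ↔
      Robin.IsLinearOnDisk F ∧ Robin.IsDisk Ω := by
    constructor
    · intro h
      have hB := Robin.nonlinearity_nonneg T F
      have hd := hder F Ω hF
      have h1 := hbound F Ω hΩ hF
      rw [h, le_div_iff₀ (by positivity)] at h1
      -- Equality gives 4T(|F'(0)|²A + B) ≤ 4T|F'(0)|²A, hence B ≤ 0.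
      have h2 : Robin.nonlinearity T F = 0 := by nlinarith
      obtain ⟨a, b, hab⟩ := Robin.isLinearOnDisk_of_deriv_eq hF.holomorphic
        (Robin.deriv_eq_of_nonlinearity_eq_zero hT hpos hF hΩ.isBounded.measure_lt_top h2)
      obtain ⟨-, ha, hΩe⟩ := hF.eq_ball_of_linear hab
      exact ⟨⟨a, b, hab⟩, b, ‖a‖, norm_pos_iff.2 ha, hΩe⟩
    · rintro ⟨⟨a, b, hab⟩, -⟩
      obtain ⟨hd, ha, rfl⟩ := hF.eq_ball_of_linear hab
      have ha' := norm_pos_iff.2 ha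
      rw [Robin.scaledEigenvalue, hd, Robin.firstEigenvalue_ball hT hα hα' hpos hpos1 b ha']
      field_simp
  rw [hdisk]
  refine ⟨⟨fun h => heq.1 (le_antisymm (hle F Ω hΩ hF) ?_), fun h F' Ω' hΩ' hF' => ?_⟩,
    hle F Ω hΩ hF, heq⟩
  -- A maximizer is compared with the identity map of the unit disk, whose value is exactly 4T.
  · have hid : Robin.IsConformalOnto (fun z : ℂ => 1 * z + 0) (Metric.ball 0 1) := by
      simpa using Robin.isConformalOnto_affine (a := 1) 0 one_ne_zero
    have h1 := h _ _ Robin.isJordanLipschitzDomain_disk hid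
    rwa [Robin.scaledEigenvalue, hdisk, Robin.deriv_affine, norm_one, one_pow, mul_one] at h1
  · rw [heq.2 h]
    exact hle F' Ω' hΩ' hF'
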